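/- **Setting.** Let $\mathbb H^3=\{(w,t): w\in\mathbb C,\ t>0\}$ be the upper half-space model of hyperbolic space, with orthonormal frame $e_1=t\,\partial_x,\ e_2=t\,\partial_y,\ e_3=t\,\partial_t$. Let $S\subset\mathbb H^3$ be a smooth embedded convex surface with outward unit normal $\nu$ (its second fundamental form $u\mapsto\langle\nabla_u\nu,u\rangle$ is $\ge 0$; a horosphere has principal curvatures $1$). Assume that $S$ is normalized: $(0,1)\in S$, the outward normal there is $-e_3$, and $\partial_x,\partial_y$ are directions of principal curvature of $S$ at $(0,1)$. So the outward normal ray of $S$ at $(0,1)$ is $\{(0,t):0<t\le 1\}$. A *normal projection* is a map $\Pi:V\to\mathbb C$ on an open set $V\subset\mathbb H^3$ containing $(0,t)$ for all $0<t<1$, such that there is a continuous map $q\mapsto a(q)\in S$ on $V$ with $a(0,t)=(0,1)$ for $0<t<1$, for which each $q\in V$ lies on the outward geodesic ray normal to $S$ at $a(q)$, at positive distance from $a(q)$, and $\Pi(q)$ is the limit in $\mathbb C$ of this ray. Let $E=\mathbb H^3\times sl_2\mathbb C$, where $sl_2\mathbb C$ is the space of projective vector fields $p(z)\frac{\partial}{\partial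 z}$ ($p$ a complex polynomial of degree $\le 2$) on $\mathbb C$, identified with the Killing fields of $\mathbb H^3$ that extend them continuously. Let $d$ be the flat connection of this product bundle, give the fibre over $x$ the inner product $\langle v,w\rangle_x=\langle v(x),w(x)\rangle+\langle (iv)(x),(iw)(x)\rangle$, let $\delta$ be the formal adjoint of $d$ for the resulting inner product on $E$-valued forms, and $\Delta=d\delta+\delta d$. For a section $s$ let $\operatorname{Re}s$ be the vector field $x\mapsto s(x)(x)$. All norms are the pointwise ones given by the hyperbolic metric and these fibre metrics, $\operatorname{div}$ is the hyperbolic divergence, and $\hat d$ is the differential of real functions. Let $v=f\frac{\partial}{\partial z}$ be a conformal vector field on $\mathbb C$ ($f$ entire). Its canonical lift assigns to $w\in\mathbb C$ the projective vector field $$s_\infty(w)=\Bigl(f(w)+f'(w)(z-w)+\tfrac12 f''(w)(z-w)^2\Bigr)\frac{\partial}{\partial z}.$$ **Proposition.** Normal projections exist. For every normal projection $\Pi:V\to\mathbb C$, the section $s=\Pi^*s_\infty$ of $E$ over $V$, $s(q)=s_\infty(\Pi(q))$, is smooth at the points $(0,t)$, $0<t<1$, and $$\|ds(0,t)\|,\qquad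 \|(\Delta s)(0,t)\|,\qquad |(\operatorname{div}\operatorname{Re}s)(0,t)|,\qquad \|\hat d(\operatorname{div}\operatorname{Re}s)(0,t)\|$$ are all $O(t^2)$ as $t\to0^+$, that is, each of them divided by $t^2$ is bounded for small $t>0$. -/

import Mathlib

open scoped Topology ContDiff ComplexConjugate
open Asymptotics

noncomputable section

namespace HypExt

/-! ### Hyperbolic space: the upper half-space `{(w, t) : t > 0} ⊆ ℂ × ℝ` -/

/-- The upper half-space model of hyperbolic 3-space. -/
def upperHalf : Set (ℂ × ℝ) := {x | 0 < x.2}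

/-- The Euclidean inner product of `ℂ × ℝ = ℝ³`. -/
def eucl (u v : ℂ × ℝ) : ℝ := u.1.re * v.1.re + u.1.im * v.1.im + u.2 * v.2

/-- The hyperbolic metric `(|dw|² + dt²) / t²` at the point `x`. -/
def metric (x u v : ℂ × ℝ) : ℝ := eucl u v / x.2 ^ 2

/-- The coordinate vector fields `∂/∂x, ∂/∂y, ∂/∂t`. -/
def coordVec : Fin 3 → ℂ × ℝ := ![(1, 0), (Complex.I, 0), (0, 1)]

/-- The hyperbolic orthonormal frame `e₁ = t ∂/∂x, e₂ = t ∂/∂y, e₃ = t ∂/∂t`. -/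
def frame (x : ℂ × ℝ) (i : Fin 3) : ℂ × ℝ := x.2 • coordVec i

/-- The Christoffel symbols of the hyperbolic metric, as a bilinear map:
`Γ(u, v) = -(u_t / t) v - (v_t / t) u + (⟨u, v⟩_eucl / t) ∂/∂t`. -/
def christoffel (x u v : ℂ × ℝ) : ℂ × ℝ :=
  -(u.2 / x.2) • v - (v.2 / x.2) • u + (eucl u v / x.2) • ((0, 1) : ℂ × ℝ)

/-- The Levi-Civita covariant derivative `(∇_u Y)(x)` of a vector field `Y`. -/
def covDeriv (Y : ℂ × ℝ → ℂ × ℝ) (x u : ℂ × ℝ) : ℂ × ℝ :=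
  fderiv ℝ Y x u + christoffel x u (Y x)

/-- The divergence of a vector field: the trace of `u ↦ ∇_u Y`. -/
def divergence (Y : ℂ × ℝ → ℂ × ℝ) (x : ℂ × ℝ) : ℝ :=
  ∑ i, metric x (covDeriv Y x (frame x i)) (frame x i)

/-- The hyperbolic norm at `x` of the differential of a real function `h`. -/
def normDiff (h : ℂ × ℝ → ℝ) (x : ℂ × ℝ) : ℝ :=
  √(∑ i, (fderiv ℝ h x (frame x i)) ^ 2)

/-- The geodesic issuing from `a` with initial velocity `u`, where `u` is a unit vector
for the hyperbolic metric at `a`, parametrized by arc length `r`. -/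
def geodesic (a u : ℂ × ℝ) (r : ℝ) : ℂ × ℝ :=
  (a.1 + (Real.sinh r / (Real.cosh r - u.2 / a.2 * Real.sinh r)) • u.1,
    a.2 / (Real.cosh r - u.2 / a.2 * Real.sinh r))

/-- `geodesic a u` starts at `a`. -/
theorem geodesic_zero (a u : ℂ × ℝ) : geodesic a u 0 = a := by
  simp [geodesic]

/-- `geodesic a u` solves the geodesic equation with initial velocity `u`. -/
theorem geodesic_equation (a u : ℂ × ℝ) (ha : a ∈ upperHalf) (hu : metric a u u = 1) :
    ∃ γ' : ℝ → ℂ × ℝ, γ' 0 = u ∧ ∀ r, HasDerivAt (geodesic a u) (γ' r) r ∧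
      HasDerivAt γ' (-christoffel (geodesic a u r) (γ' r) (γ' r)) r := by
  have ha' : 0 < a.2 := ha
  set β := u.2 / a.2 with hβ
  have hub : u.2 = β * a.2 := by rw [hβ]; field_simp
  have hn : u.1.re ^ 2 + u.1.im ^ 2 = (1 - β ^ 2) * a.2 ^ 2 := by
    simp only [metric, eucl] at hu
    rw [div_eq_one_iff_eq (by positivity)] at hu
    rw [hub] at hu
    nlinarith
  have hβ1 : β ^ 2 ≤ 1 := by
    have h0 : 0 ≤ (1 - β ^ 2) * a.2 ^ 2 := by rw [← hn]; positivity
    have := nonneg_of_mul_nonneg_left h0 (by positivity)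
    linarith
  have hpos : ∀ r : ℝ, 0 < Real.cosh r - β * Real.sinh r := by
    intro r
    have h1 := abs_le.1 ((sq_le_one_iff_abs_le_one β).1 hβ1)
    have h2 := Real.cosh_add_sinh r
    have h3 := Real.cosh_sub_sinh r
    have h4 := Real.exp_pos r
    have h5 := Real.exp_pos (-r)
    rcases lt_or_ge 0 (Real.sinh r) with h | h
    · nlinarith
    · nlinarith
  have hD : ∀ r : ℝ, HasDerivAt (fun r => Real.cosh r - β * Real.sinh r)
      (Real.sinh r - β * Real.cosh r) r := fun r =>
    (Real.hasDerivAt_cosh r).sub ((Real.hasDerivAt_sinh r).const_mul β)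
  have hD' : ∀ r : ℝ, HasDerivAt (fun r => Real.sinh r - β * Real.cosh r)
      (Real.cosh r - β * Real.sinh r) r := fun r =>
    (Real.hasDerivAt_sinh r).sub ((Real.hasDerivAt_cosh r).const_mul β)
  refine ⟨fun r => ((1 / (Real.cosh r - β * Real.sinh r) ^ 2) • u.1,
    -a.2 * (Real.sinh r - β * Real.cosh r) / (Real.cosh r - β * Real.sinh r) ^ 2), ?_, ?_⟩
  · ext1
    · simp
    · simp [hub]
      ring
  · intro r
    have hp := (hpos r).ne'
    have hcs := Real.cosh_sq r
    constructor
    · have h1 := (((Real.hasDerivAt_sinh r).div (hD r) hp).smul_const u.1).const_add a.1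
      have h2 := (hasDerivAt_const r a.2).div (hD r) hp
      have h3 : HasDerivAt (geodesic a u) _ r := h1.prodMk h2
      refine h3.congr_deriv (Prod.ext ?_ ?_)
      · have e : Real.cosh r * (Real.cosh r - β * Real.sinh r) -
            Real.sinh r * (Real.sinh r - β * Real.cosh r) = 1 := by nlinarith
        simp only [e]
      · simp only
        congr 1
        ring
    · have h1 := ((hasDerivAt_const r (1 : ℝ)).div ((hD r).pow 2) (pow_ne_zero 2 hp)).smul_const
        u.1
      have h2 := ((hD' r).const_mul (-a.2)).div ((hD r).pow 2) (pow_ne_zero 2 hp)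
      refine (h1.prodMk h2).congr_deriv ?_
      have key : (Real.cosh r - β * Real.sinh r) ^ 2 - (Real.sinh r - β * Real.cosh r) ^ 2
          = 1 - β ^ 2 := by
        nlinarith
      simp only [christoffel, geodesic, eucl, ← hβ, Pi.pow_apply]
      clear h1 h2 hcs hD hD' hpos
      generalize Real.cosh r - β * Real.sinh r = D at *
      generalize Real.sinh r - β * Real.cosh r = D' at *
      refine Prod.ext (Complex.ext ?_ ?_) ?_
      · simp [-Complex.real_smul, Complex.smul_re, Complex.smul_im]
        field_simp
        ring
      · simp [-Complex.real_smul, Complex.smul_re, Complex.smul_im]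
        field_simp
        ring
      · simp [-Complex.real_smul, Complex.smul_re, Complex.smul_im]
        field_simp
        linear_combination (-a.2 ^ 2) * key + hn

/-! ### Convex surfaces and the normal projection

An embedded co-oriented surface in hyperbolic space is given as the zero set of a smooth
function `φ` with nowhere vanishing differential on an open set `O` of the upper half-space;
the co-orientation is the direction in which `φ` increases. -/

/-- The hyperbolic gradient `grad φ = t² (φ_x, φ_y, φ_t)`. -/
def grad (φ : ℂ × ℝ → ℝ) (x : ℂ × ℝ) : ℂ × ℝ :=
  x.2 ^ 2 • ∑ i, fderiv ℝ φ x (coordVec i) • coordVec i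

/-- The unit normal field `grad φ / |grad φ|` of the level sets of `φ`. -/
def unitNormal (φ : ℂ × ℝ → ℝ) (x : ℂ × ℝ) : ℂ × ℝ :=
  (√(metric x (grad φ x) (grad φ x)))⁻¹ • grad φ x

/-- The surface `{φ = 0}` in `O`. -/
def surface (O : Set (ℂ × ℝ)) (φ : ℂ × ℝ → ℝ) : Set (ℂ × ℝ) := {x | x ∈ O ∧ φ x = 0}

/-- `surface O φ` is a smooth embedded surface in hyperbolic space which is convex, that is,
its second fundamental form `u ↦ ⟨∇_u ν, u⟩` with respect to the outward unit normal
`ν = unitNormal φ` is nonnegative (horospheres, with `ν` pointing out of the horoball, have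
principal curvatures `1`). -/
structure IsConvexSurface (O : Set (ℂ × ℝ)) (φ : ℂ × ℝ → ℝ) : Prop where
  isOpen : IsOpen O
  subset : O ⊆ upperHalf
  smooth : ContDiffOn ℝ ∞ φ O
  regular : ∀ x ∈ surface O φ, fderiv ℝ φ x ≠ 0
  convex : ∀ x ∈ surface O φ, ∀ u : ℂ × ℝ, fderiv ℝ φ x u = 0 →
    0 ≤ metric x (covDeriv (unitNormal φ) x u) u

/-- The position of the surface is normalized: it passes through `(0, 1)`, the outward unit
normal there is `-e₃` (so that the outward normal ray is `{(0, t) : 0 < t ≤ 1}`), and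
`∂/∂x`, `∂/∂y` are directions of principal curvature there, that is, eigenvectors of the shape
operator `u ↦ ∇_u ν`. -/
structure IsNormalized (O : Set (ℂ × ℝ)) (φ : ℂ × ℝ → ℝ) : Prop where
  mem : ((0, 1) : ℂ × ℝ) ∈ surface O φ
  normal : unitNormal φ (0, 1) = (0, -1)
  principal_fst : ∃ k₁ : ℝ, covDeriv (unitNormal φ) (0, 1) (1, 0) = k₁ • ((1, 0) : ℂ × ℝ)
  principal_snd : ∃ k₂ : ℝ,
    covDeriv (unitNormal φ) (0, 1) (Complex.I, 0) = k₂ • ((Complex.I, 0) : ℂ × ℝ)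

/-- `P : V → ℂ` is the projection along the outward normal rays of the surface, on a
neighborhood `V` of the open normal ray `{(0, t) : 0 < t < 1}`. Every `q ∈ V` lies on the
outward normal ray of the surface that starts at the foot point `foot q`, at some distance
`r > 0` from it (so on the outer parallel surface at distance `r`); the foot point depends
continuously on `q` and is `(0, 1)` for the points of the given ray; and `P q` is the limit in
`ℂ` of the normal ray through `q`. -/
def IsNormalProjection (O : Set (ℂ × ℝ)) (φ : ℂ × ℝ → ℝ) (V : Set (ℂ × ℝ))
    (P : ℂ × ℝ → ℂ) : Prop :=
  IsOpen V ∧ V ⊆ upperHalf ∧ (∀ t ∈ Set.Ioo (0 : ℝ) 1, ((0, t) : ℂ × ℝ) ∈ V) ∧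
  ∃ foot : ℂ × ℝ → ℂ × ℝ,
    ContinuousOn foot V ∧
    (∀ t ∈ Set.Ioo (0 : ℝ) 1, foot (0, t) = (0, 1)) ∧
    ∀ q ∈ V, foot q ∈ surface O φ ∧
      (∃ r : ℝ, 0 < r ∧ geodesic (foot q) (unitNormal φ (foot q)) r = q) ∧
      Filter.Tendsto (geodesic (foot q) (unitNormal φ (foot q))) Filter.atTop
        (𝓝 ((P q, 0) : ℂ × ℝ))

/-! ### The flat bundle `E`

Its fibre is `sl₂ℂ`, realized as the space of projective vector fields
`(q₀ + q₁ z + q₂ z²) ∂/∂z` on `ℂ`, or equivalently as the space of the Killing fields of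
hyperbolic space which extend them. Sections of the (trivialized) bundle are functions with
values in `sl₂ℂ`, and the flat connection is the ordinary derivative. -/

/-- Projective vector fields `(q 0 + q 1 z + q 2 z²) ∂/∂z`. -/
abbrev ProjField : Type := Fin 3 → ℂ

/-- The coefficient of `∂/∂z` at `z`. -/
def ProjField.eval (q : ProjField) (z : ℂ) : ℂ := q 0 + q 1 * z + q 2 * z ^ 2

/-- The Killing field of hyperbolic space that extends continuously to `q` on `ℂ`:
with `p = q.eval`, it is `(p(w) - t² conj(p''(w)) / 2, t Re p'(w))` at `(w, t)`. The complex
structure of `sl₂ℂ` is multiplication of `q` by `i`. -/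
def killing (q : ProjField) (x : ℂ × ℝ) : ℂ × ℝ :=
  (q.eval x.1 - (x.2 : ℂ) ^ 2 * conj (q 2), x.2 * (q 1 + 2 * q 2 * x.1).re)

/-- The inner product on the fibre at `x`:
`⟨p, q⟩_x = ⟨p(x), q(x)⟩ + ⟨(i p)(x), (i q)(x)⟩`. -/
def fiberInner (x : ℂ × ℝ) (p q : ProjField) : ℝ :=
  metric x (killing p x) (killing q x) +
    metric x (killing (Complex.I • p) x) (killing (Complex.I • q) x)

/-- The pointwise norm of a section of `E`. -/
def fiberNorm (x : ℂ × ℝ) (p : ProjField) : ℝ := √(fiberInner x p p)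

/-- The pointwise norm of an `E`-valued 1-form. -/
def formNorm (x : ℂ × ℝ) (α : ℂ × ℝ →L[ℝ] ProjField) : ℝ :=
  √(∑ i, fiberInner x (α (frame x i)) (α (frame x i)))

theorem fiberInner_add_right (x : ℂ × ℝ) (p q q' : ProjField) :
    fiberInner x p (q + q') = fiberInner x p q + fiberInner x p q' := by
  simp [fiberInner, metric, eucl, killing, ProjField.eval, -Complex.inv_I]
  ring

theorem fiberInner_smul_right (x : ℂ × ℝ) (p q : ProjField) (c : ℝ) :
    fiberInner x p (c • q) = c * fiberInner x p q := by
  simp [fiberInner, metric, eucl, killing, ProjField.eval]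
  ring

theorem fiberInner_comm (x : ℂ × ℝ) (p q : ProjField) :
    fiberInner x p q = fiberInner x q p := by
  simp only [fiberInner, metric, eucl]
  ring

/-- The bundle map from `E` to the dual bundle given by the inner product. -/
def sharp (x : ℂ × ℝ) (p : ProjField) : ProjField →L[ℝ] ℝ :=
  LinearMap.toContinuousLinearMap
    { toFun := fun q => fiberInner x p q
      map_add' := fiberInner_add_right x p
      map_smul' := fun c q => by simpa using fiberInner_smul_right x p q c }

/-- The inner product on the fibres is positive definite, so `sharp` is an isomorphism. -/
theorem sharp_bijective (x : ℂ × ℝ) (hx : x ∈ upperHalf) : Function.Bijective (sharp x) := by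
  have hx' : 0 < x.2 := hx
  have hs : ∀ p q, sharp x p q = fiberInner x p q := fun _ _ => rfl
  let L : ProjField →ₗ[ℝ] (ProjField →L[ℝ] ℝ) :=
    { toFun := sharp x
      map_add' := fun p q => by
        ext1 v
        simp only [_root_.add_apply, hs]
        rw [fiberInner_comm, fiberInner_add_right, fiberInner_comm x v p, fiberInner_comm x v q]
      map_smul' := fun c p => by
        ext1 v
        simp only [_root_.smul_apply, hs, RingHom.id_apply, smul_eq_mul]
        rw [fiberInner_comm, fiberInner_smul_right, fiberInner_comm x v p] }
  have hinj : Function.Injective L := by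
    rw [injective_iff_map_eq_zero]
    intro p hp
    have h0 : fiberInner x p p = 0 := by
      rw [← hs]
      exact DFunLike.congr_fun hp p
    set A := p.eval x.1 with hA
    set B := p 1 + 2 * p 2 * x.1 with hB
    have hE : fiberInner x p p =
        (2 * (A.re ^ 2 + A.im ^ 2) + x.2 ^ 2 * (B.re ^ 2 + B.im ^ 2) +
          2 * x.2 ^ 4 * ((p 2).re ^ 2 + (p 2).im ^ 2)) / x.2 ^ 2 := by
      have hIA : (Complex.I • p : ProjField).eval x.1 = Complex.I * A := by
        simp [ProjField.eval, hA]; ring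
      have hIB : (Complex.I • p : ProjField) 1 + 2 * (Complex.I • p : ProjField) 2 * x.1
          = Complex.I * B := by
        simp [hB]; ring
      simp only [fiberInner, metric, eucl, killing, hIA, hIB, ← hA, ← hB]
      simp [← Complex.ofReal_pow]
      ring
    rw [hE, div_eq_zero_iff] at h0
    have h1 := h0.resolve_right (by positivity)
    have q1 : 0 ≤ A.re ^ 2 + A.im ^ 2 := by positivity
    have q2 : 0 ≤ x.2 ^ 2 * (B.re ^ 2 + B.im ^ 2) := by positivity
    have q3 : 0 ≤ 2 * x.2 ^ 4 * ((p 2).re ^ 2 + (p 2).im ^ 2) := by positivity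
    have a0 : A.re ^ 2 + A.im ^ 2 = 0 := by linarith
    have b0 : B.re ^ 2 + B.im ^ 2 = 0 := by
      have : x.2 ^ 2 * (B.re ^ 2 + B.im ^ 2) = 0 := by linarith
      exact (mul_eq_zero.1 this).resolve_left (by positivity)
    have c0 : (p 2).re ^ 2 + (p 2).im ^ 2 = 0 := by
      have : 2 * x.2 ^ 4 * ((p 2).re ^ 2 + (p 2).im ^ 2) = 0 := by linarith
      exact (mul_eq_zero.1 this).resolve_left (by positivity)
    have hz : ∀ z : ℂ, z.re ^ 2 + z.im ^ 2 = 0 → z = 0 := fun z h => by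
      apply Complex.ext
      · simp; nlinarith [sq_nonneg z.re, sq_nonneg z.im]
      · simp; nlinarith [sq_nonneg z.re, sq_nonneg z.im]
    have c1 := hz _ c0
    have b1 := hz _ b0
    have a1 := hz _ a0
    rw [hB, c1] at b1
    have b2 : p 1 = 0 := by simpa using b1
    rw [hA, ProjField.eval, c1, b2] at a1
    have a2 : p 0 = 0 := by simpa using a1
    funext i
    fin_cases i
    · exact a2
    · exact b2
    · exact c1
  have hfin : Module.finrank ℝ ProjField = Module.finrank ℝ (ProjField →L[ℝ] ℝ) := by
    rw [← (LinearMap.toContinuousLinearMap (𝕜 := ℝ) (E := ProjField) (F' := ℝ)).finrank_eq]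
    exact (Subspace.dual_finrank_eq (K := ℝ) (V := ProjField)).symm
  exact ⟨hinj, (LinearMap.injective_iff_surjective_of_finrank_eq_finrank hfin).1 hinj⟩

/-- The inverse of `sharp`. -/
def flat (x : ℂ × ℝ) : (ProjField →L[ℝ] ℝ) → ProjField := Function.invFun (sharp x)

/-- The exterior derivative `ds` of a section of `E`. -/
def extD (s : ℂ × ℝ → ProjField) : ℂ × ℝ → (ℂ × ℝ →L[ℝ] ProjField) := fderiv ℝ s

/-- The formal adjoint `δ = - * ∂ *` of `d` on `E`-valued 1-forms, where
`∂ = flat ∘ d ∘ sharp` with the flat exterior derivative `d` of the dual bundle. For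
`α = ∑ αᵢ dxⁱ` one has `*(sharp α) = ∑ t⁻¹ (sharp αᵢ) *_eucl dxⁱ`, and `* (dx ∧ dy ∧ dt) = t³`;
so `δ α = - flat (t³ ∑ᵢ ∂ᵢ (t⁻¹ sharp αᵢ))`. -/
def codiff (α : ℂ × ℝ → (ℂ × ℝ →L[ℝ] ProjField)) (x : ℂ × ℝ) : ProjField :=
  -flat x (x.2 ^ 3 •
    ∑ i, fderiv ℝ (fun y : ℂ × ℝ => y.2⁻¹ • sharp y (α y (coordVec i))) x (coordVec i))

/-- The Laplacian `Δ = dδ + δd` on sections of `E`, where the first term is zero. -/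
def laplacian (s : ℂ × ℝ → ProjField) : ℂ × ℝ → ProjField := codiff (extD s)

/-- The real part of a section: the vector field `x ↦ s(x)(x)`. -/
def realPart (s : ℂ × ℝ → ProjField) (x : ℂ × ℝ) : ℂ × ℝ := killing (s x) x

/-- The canonical lift of the conformal vector field `f ∂/∂z`: at `w`, it is the projective
vector field whose 2-jet at `w` is that of `f ∂/∂z`. -/
def canonicalLift (f : ℂ → ℂ) (w : ℂ) : ProjField :=
  ![f w - deriv f w * w + deriv (deriv f) w / 2 * w ^ 2,
    deriv f w - deriv (deriv f) w * w,
    deriv (deriv f) w / 2]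

theorem canonicalLift_eval (f : ℂ → ℂ) (w z : ℂ) :
    (canonicalLift f w).eval z =
      f w + deriv f w * (z - w) + deriv (deriv f) w / 2 * (z - w) ^ 2 := by
  simp [canonicalLift, ProjField.eval]
  ring

end HypExt

end

/-! The point is that the normal projection extends smoothly past the end point of the ray at
infinity, in Euclidean coordinates. With `τ = exp (-r)` as parameter, a geodesic ray becomes a
rational curve that is smooth at `τ = 0`, where it reaches its limit in `ℂ`. The normal exponential
map `(a, τ) ↦ rayPoint a (ν a) τ` is therefore smooth along the closed ray `0 ≤ τ ≤ 1`. Pairing it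
with `φ a` lets `a` range over an open set and makes the map equidimensional (`normalMap`).
Convexity excludes focal points, also at `τ = 0` (`fderiv_normalMap_injective`). The inverse
function theorem on a tube around the compact segment then gives a map `Q`, smooth at every `(0, τ)`
with `0 ≤ τ ≤ 1`, that agrees near the open ray with every normal projection
(`exists_projection_chart`).

The powers of `t` come from the canonical lift. It osculates `f` to second order, so its derivative
at `w` is `f'''(w)/2` times `(z - w)² ∂/∂z` (`hasDerivAt_canonicalLift`). Hence `ds = g ⊗ (z - Q)²
∂/∂z` with `g` smooth up to `t = 0`. On the ray `Q = 0`, and `z² ∂/∂z` has fibre norm `√2 t` at `(0,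
t)`; the frame `t ∂ᵢ` supplies the second factor `t`. The same count governs `Δs` and the
divergence: terms quadratic in `w - Q` have zero first derivative on the ray, and what survives is
`t²` times a quantity continuous at `t = 0` (`codiff_axis`, `fderiv_divergence_model`). -/

namespace HypExt

/-! ### Inverse function theorem along a compact segment -/

/-- A map whose derivative along the segment `{a} × [0, 1]` is injective, and which is injective
on this segment, has a local inverse on a tube around the segment. -/
theorem exists_inverse_near_segment {X : Type*} [NormedAddCommGroup X] [NormedSpace ℝ X]
    [FiniteDimensional ℝ X] (F : X × ℝ → X × ℝ) (a : X) {A₀ : Set X} (hA₀ : A₀ ∈ 𝓝 a)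
    (hF : ∀ τ ∈ Set.Icc (0 : ℝ) 1, ContDiffAt ℝ ∞ F (a, τ))
    (hker : ∀ τ ∈ Set.Icc (0 : ℝ) 1, ∀ v, fderiv ℝ F (a, τ) v = 0 → v = 0)
    (hinj : ∀ τ ∈ Set.Icc (0 : ℝ) 1, ∀ σ ∈ Set.Icc (0 : ℝ) 1, F (a, τ) = F (a, σ) → τ = σ) :
    ∃ A : Set X, IsOpen A ∧ a ∈ A ∧ A ⊆ A₀ ∧ ∃ Θ : X × ℝ → X × ℝ,
      (∀ z ∈ A, ∀ τ ∈ Set.Icc (0 : ℝ) 1, Θ (F (z, τ)) = (z, τ)) ∧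
      ∀ τ ∈ Set.Icc (0 : ℝ) 1, ContDiffAt ℝ ∞ Θ (F (a, τ)) ∧
        ∀ᶠ y in 𝓝 (F (a, τ)), F (Θ y) = y := by
  have hequiv : ∀ τ ∈ Set.Icc (0 : ℝ) 1, ∃ F' : (X × ℝ) ≃L[ℝ] (X × ℝ),
      HasFDerivAt F (F' : X × ℝ →L[ℝ] X × ℝ) (a, τ) := by
    intro τ hτ
    have hi : Function.Injective (fderiv ℝ F (a, τ) : X × ℝ →ₗ[ℝ] X × ℝ) := by
      rw [injective_iff_map_eq_zero]
      exact hker τ hτ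
    refine ⟨(LinearEquiv.ofInjectiveEndo _ hi).toContinuousLinearEquiv, ?_⟩
    refine ((hF τ hτ).differentiableAt (by simp)).hasFDerivAt.congr_fderiv ?_
    ext v <;> rfl
  have hK : IsCompact (({a} : Set X) ×ˢ Set.Icc (0 : ℝ) 1) :=
    isCompact_singleton.prod isCompact_Icc
  obtain ⟨W, hW, hWinj⟩ : ∃ W ∈ 𝓝ˢ (({a} : Set X) ×ˢ Set.Icc (0 : ℝ) 1), Set.InjOn F W := by
    -- Injectivity on a compact set together with local injectivity at each of its points gives
    -- injectivity on a neighborhood.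
    refine Set.InjOn.exists_mem_nhdsSet ?_ hK ?_ ?_
    · rintro ⟨x, τ⟩ ⟨rfl, hτ⟩ ⟨y, σ⟩ ⟨rfl, hσ⟩ h
      rw [hinj τ hτ σ hσ h]
    · rintro ⟨x, τ⟩ ⟨rfl, hτ⟩
      exact (hF τ hτ).continuousAt
    · rintro ⟨x, τ⟩ ⟨rfl, hτ⟩
      obtain ⟨F', hF'⟩ := hequiv τ hτ
      let e := (hF τ hτ).toOpenPartialHomeomorph F hF' (by simp)
      exact ⟨e.source, e.open_source.mem_nhds
        ((hF τ hτ).mem_toOpenPartialHomeomorph_source hF' (by simp)), e.injOn⟩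
  obtain ⟨W', hW'o, hKW', hW'W⟩ := mem_nhdsSet_iff_exists.1 hW
  obtain ⟨A₁, I, hA₁o, -, haA₁, hI, hA₁I⟩ :=
    generalized_tube_lemma isCompact_singleton isCompact_Icc hW'o hKW'
  obtain ⟨A₂, hA₂, hA₂o, haA₂⟩ := mem_nhds_iff.1 hA₀
  have hWinj' : Set.InjOn F W' := hWinj.mono hW'W
  have : Nonempty (X × ℝ) := ⟨(a, 0)⟩
  have hΘ : ∀ y ∈ W', Function.invFunOn F W' (F y) = y := hWinj'.leftInvOn_invFunOn
  refine ⟨A₁ ∩ A₂, hA₁o.inter hA₂o, ⟨haA₁ rfl, haA₂⟩, fun x hx => hA₂ hx.2,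
    Function.invFunOn F W', fun z hz τ hτ => hΘ _ (hA₁I ⟨hz.1, hI hτ⟩), fun τ hτ => ?_⟩
  obtain ⟨F', hF'⟩ := hequiv τ hτ
  have hs := (hF τ hτ).hasStrictFDerivAt' hF' (by simp)
  have hmem : (a, τ) ∈ W' := hKW' ⟨rfl, hτ⟩
  have hev : ∀ᶠ y in 𝓝 (F (a, τ)), (hs.localInverse F F' (a, τ)) y ∈ W' :=
    hs.localInverse_tendsto (hW'o.mem_nhds hmem)
  -- One set-theoretic inverse serves the whole tube. Its smoothness is local: by injectivity on
  -- `W'` it coincides with the local inverse, whose values near `F (a, τ)` stay in `W'`.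
  have heq : Function.invFunOn F W' =ᶠ[𝓝 (F (a, τ))] hs.localInverse F F' (a, τ) := by
    filter_upwards [hev, hs.eventually_right_inverse] with y hy hy'
    conv_lhs => rw [← hy']
    exact hΘ _ hy
  refine ⟨((hF τ hτ).to_localInverse hF' (by simp)).congr_of_eventuallyEq heq, ?_⟩
  filter_upwards [heq, hs.eventually_right_inverse] with y hy hy'
  rw [hy, hy']

/-! ### Geodesic rays up to their end points -/

/-- The point at distance `-log τ` on the geodesic ray from `a` with initial velocity `u`; for
`τ = 0` it is the end point of the ray. -/
noncomputable def rayPoint (a u : ℂ × ℝ) (τ : ℝ) : ℂ × ℝ :=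
  (a.1 + ((1 - τ ^ 2) / ((1 + τ ^ 2) - u.2 / a.2 * (1 - τ ^ 2))) • u.1,
    2 * τ * a.2 / ((1 + τ ^ 2) - u.2 / a.2 * (1 - τ ^ 2)))

/-- With `τ = exp (-r)` one has `1 - τ² = 2τ sinh r` and `1 + τ² = 2τ cosh r`, so the two
expressions differ by cancelling `2τ`. -/
theorem geodesic_eq_rayPoint (a u : ℂ × ℝ) (r : ℝ) :
    geodesic a u r = rayPoint a u (Real.exp (-r)) := by
  have h0 : Real.exp (-r) ≠ 0 := (Real.exp_pos _).ne'
  have hr : Real.exp r = (Real.exp (-r))⁻¹ := by rw [Real.exp_neg, inv_inv]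
  have hs : 1 - Real.exp (-r) ^ 2 = 2 * Real.exp (-r) * Real.sinh r := by
    rw [Real.sinh_eq, hr]; field_simp
  have hc : 1 + Real.exp (-r) ^ 2 = 2 * Real.exp (-r) * Real.cosh r := by
    rw [Real.cosh_eq, hr]; field_simp
  have hD : 2 * Real.exp (-r) * Real.cosh r - u.2 / a.2 * (2 * Real.exp (-r) * Real.sinh r)
      = 2 * Real.exp (-r) * (Real.cosh r - u.2 / a.2 * Real.sinh r) := by ring
  have h2 : 2 * Real.exp (-r) ≠ 0 := by positivity
  simp only [geodesic, rayPoint, hs, hc, hD, mul_div_mul_left _ _ h2]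

theorem continuous_rayPoint (a u : ℂ × ℝ) (hβ : u.2 / a.2 < 0) :
    ContinuousAt (rayPoint a u) 0 := by
  have h : (1 + (0 : ℝ) ^ 2) - u.2 / a.2 * (1 - (0 : ℝ) ^ 2) ≠ 0 := by
    have : 0 < (1 + (0 : ℝ) ^ 2) - u.2 / a.2 * (1 - (0 : ℝ) ^ 2) := by norm_num; linarith
    exact this.ne'
  have hD : Continuous fun τ : ℝ => (1 + τ ^ 2) - u.2 / a.2 * (1 - τ ^ 2) := by fun_prop
  have hn : Continuous fun τ : ℝ => 1 - τ ^ 2 := by fun_prop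
  have hm : Continuous fun τ : ℝ => 2 * τ * a.2 := by fun_prop
  unfold rayPoint
  exact ContinuousAt.prodMk (continuousAt_const.add (ContinuousAt.smul
    (hn.continuousAt.div hD.continuousAt h) continuousAt_const))
    (hm.continuousAt.div hD.continuousAt h)

/-- The geodesic ray ends at `rayPoint a u 0`. -/
theorem tendsto_geodesic (a u : ℂ × ℝ) (hβ : u.2 / a.2 < 0) :
    Filter.Tendsto (geodesic a u) Filter.atTop (𝓝 (((rayPoint a u 0).1, 0) : ℂ × ℝ)) := by
  have h : (((rayPoint a u 0).1, 0) : ℂ × ℝ) = rayPoint a u 0 := by simp [rayPoint]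
  rw [h, funext (geodesic_eq_rayPoint a u)]
  exact (continuous_rayPoint a u hβ).tendsto.comp
    (Real.tendsto_exp_atBot.comp Filter.tendsto_neg_atTop_atBot)

/-! ### The normal exponential map of a convex surface -/

/-- The normal exponential map of the level sets of `φ`, paired with `φ`. -/
noncomputable def normalMap (φ : ℂ × ℝ → ℝ) (z : (ℂ × ℝ) × ℝ) : (ℂ × ℝ) × ℝ :=
  (rayPoint z.1 (unitNormal φ z.1) z.2, φ z.1)

theorem contDiffAt_unitNormal {φ : ℂ × ℝ → ℝ} {a : ℂ × ℝ} (hφ : ContDiffAt ℝ ∞ φ a)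
    (ha : a.2 ≠ 0) (hν : unitNormal φ a ≠ 0) : ContDiffAt ℝ ∞ (unitNormal φ) a := by
  -- Where the gradient has norm zero, `unitNormal` takes the value `0` because `0⁻¹ = 0`; a nonzero
  -- value thus certifies a nonzero norm.
  have hm : metric a (grad φ a) (grad φ a) ≠ 0 := by
    intro h
    exact hν (by simp [unitNormal, h])
  have hd : ContDiffAt ℝ ∞ (fderiv ℝ φ) a := hφ.fderiv_right (by simp)
  have hg : ContDiffAt ℝ ∞ (grad φ) a := by
    unfold grad
    exact (contDiffAt_snd.pow 2).smul (ContDiffAt.sum fun i _ =>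
      (hd.clm_apply contDiffAt_const).smul contDiffAt_const)
  have h1 : ContDiffAt ℝ ∞ (fun x => (grad φ x).1.re) a :=
    Complex.reCLM.contDiff.contDiffAt.comp a hg.fst
  have h2 : ContDiffAt ℝ ∞ (fun x => (grad φ x).1.im) a :=
    Complex.imCLM.contDiff.contDiffAt.comp a hg.fst
  have hmm : ContDiffAt ℝ ∞ (fun x => metric x (grad φ x) (grad φ x)) a := by
    unfold metric eucl
    exact (((h1.mul h1).add (h2.mul h2)).add (hg.snd.mul hg.snd)).div (contDiffAt_snd.pow 2)
      (pow_ne_zero 2 ha)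
  have hs : √(metric a (grad φ a) (grad φ a)) ≠ 0 := by
    intro h
    exact hν (by simp [unitNormal, h])
  unfold unitNormal
  exact ((hmm.sqrt hm).inv hs).smul hg

theorem contDiffAt_rayPoint {a u : (ℂ × ℝ) × ℝ → ℂ × ℝ} {τ : (ℂ × ℝ) × ℝ → ℝ} {z : (ℂ × ℝ) × ℝ}
    (ha : ContDiffAt ℝ ∞ a z) (hu : ContDiffAt ℝ ∞ u z) (hτ : ContDiffAt ℝ ∞ τ z)
    (h0 : (a z).2 ≠ 0) (hD : (1 + τ z ^ 2) - (u z).2 / (a z).2 * (1 - τ z ^ 2) ≠ 0) :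
    ContDiffAt ℝ ∞ (fun z => rayPoint (a z) (u z) (τ z)) z := by
  have hD' : ContDiffAt ℝ ∞ (fun z => (1 + τ z ^ 2) - (u z).2 / (a z).2 * (1 - τ z ^ 2)) z :=
    (contDiffAt_const.add (hτ.pow 2)).sub
      ((hu.snd.div ha.snd h0).mul (contDiffAt_const.sub (hτ.pow 2)))
  unfold rayPoint
  exact (ha.fst.add (((contDiffAt_const.sub (hτ.pow 2)).div hD' hD).smul hu.fst)).prodMk
    (((contDiffAt_const.mul hτ).mul ha.snd).div hD' hD)

section Surface

variable {O : Set (ℂ × ℝ)} {φ : ℂ × ℝ → ℝ}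

theorem IsConvexSurface.contDiffAt (hS : IsConvexSurface O φ) {x : ℂ × ℝ} (hx : x ∈ O) :
    ContDiffAt ℝ ∞ φ x :=
  hS.smooth.contDiffAt (hS.isOpen.mem_nhds hx)

theorem contDiffAt_unitNormal_base (hS : IsConvexSurface O φ) (hN : IsNormalized O φ) :
    ContDiffAt ℝ ∞ (unitNormal φ) (0, 1) :=
  contDiffAt_unitNormal (hS.contDiffAt hN.mem.1) (by simp) (by simp [hN.normal])

theorem contDiffAt_normalMap (hS : IsConvexSurface O φ) (hN : IsNormalized O φ) (τ : ℝ) :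
    ContDiffAt ℝ ∞ (normalMap φ) ((0, 1), τ) := by
  have hν : ContDiffAt ℝ ∞ (fun z : (ℂ × ℝ) × ℝ => unitNormal φ z.1) ((0, 1), τ) :=
    (contDiffAt_unitNormal_base hS hN).comp (((0, 1), τ) : (ℂ × ℝ) × ℝ) contDiffAt_fst
  have hφ : ContDiffAt ℝ ∞ (fun z : (ℂ × ℝ) × ℝ => φ z.1) ((0, 1), τ) :=
    (hS.contDiffAt hN.mem.1).comp (((0, 1), τ) : (ℂ × ℝ) × ℝ) contDiffAt_fst
  exact (contDiffAt_rayPoint contDiffAt_fst hν contDiffAt_snd (by simp)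
    (by
      have h : (1 + τ ^ 2) - (-1 : ℝ) / 1 * (1 - τ ^ 2) = 2 := by ring
      simp only [hN.normal, h]
      norm_num)).prodMk hφ

theorem normalMap_base (hN : IsNormalized O φ) (τ : ℝ) :
    normalMap φ ((0, 1), τ) = ((0, τ), 0) := by
  have h : (1 + τ ^ 2) - (τ ^ 2 - 1) = 2 := by ring
  simp [normalMap, rayPoint, hN.normal, hN.mem.2, h]

/-- The tangent plane of the surface at the base point is horizontal. -/
theorem fderiv_eq_zero_iff (hN : IsNormalized O φ) {u : ℂ × ℝ} :
    fderiv ℝ φ (0, 1) u = 0 ↔ u.2 = 0 := by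
  have hn := hN.normal
  have e : ∀ v : ℂ × ℝ, v = v.1.re • coordVec 0 + v.1.im • coordVec 1 + v.2 • coordVec 2 := by
    intro v
    refine Prod.ext (Complex.ext ?_ ?_) ?_ <;> simp [coordVec]
  simp only [unitNormal, grad, Fin.sum_univ_three] at hn
  -- With `c` the normalizing factor, the vertical component reads `c * φ_t = -1`, so `c` and `φ_t`
  -- are nonzero; the horizontal components then force `φ_x = φ_y = 0`.
  set c := (√(metric (0, 1) (((0, 1) : ℂ × ℝ).2 ^ 2 • (_ + _ + _)) _))⁻¹
  have h1 := congrArg (fun v : ℂ × ℝ => v.1.re) hn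
  have h2 := congrArg (fun v : ℂ × ℝ => v.1.im) hn
  have h3 := congrArg (fun v : ℂ × ℝ => v.2) hn
  simp [coordVec] at h1 h2 h3
  have hc : c ≠ 0 := by rintro hc; rw [hc] at h3; simp at h3
  have h4 : fderiv ℝ φ (0, 1) (0, 1) ≠ 0 := by rintro hc; rw [hc] at h3; simp at h3
  rw [e u, map_add, map_add, map_smul, map_smul, map_smul]
  simp [coordVec, h1.resolve_left hc, h2.resolve_left hc, h4]

/-- The derivative of the unit normal at the base point, in terms of nonnegative principal
curvatures. -/
theorem exists_fderiv_unitNormal (hS : IsConvexSurface O φ) (hN : IsNormalized O φ) :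
    ∃ k₁ k₂ : ℝ, 0 ≤ k₁ ∧ 0 ≤ k₂ ∧ ∀ u : ℂ × ℝ, u.2 = 0 →
      fderiv ℝ (unitNormal φ) (0, 1) u = (⟨(k₁ - 1) * u.1.re, (k₂ - 1) * u.1.im⟩, 0) := by
  obtain ⟨k₁, h1⟩ := hN.principal_fst
  obtain ⟨k₂, h2⟩ := hN.principal_snd
  have p1 := hS.convex _ hN.mem (1, 0) ((fderiv_eq_zero_iff hN).2 rfl)
  have p2 := hS.convex _ hN.mem (Complex.I, 0) ((fderiv_eq_zero_iff hN).2 rfl)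
  rw [h1] at p1
  rw [h2] at p2
  simp only [covDeriv, hN.normal] at h1 h2
  -- At the base point the Christoffel term of a horizontal `u` with `ν = (0, -1)` is `u` itself;
  -- this accounts for the `-1` in `k - 1`.
  rw [← eq_sub_iff_add_eq] at h1 h2
  refine ⟨k₁, k₂, by simpa [metric, eucl] using p1, by simpa [metric, eucl] using p2, ?_⟩
  intro u hu
  have e : u = u.1.re • ((1, 0) : ℂ × ℝ) + u.1.im • ((Complex.I, 0) : ℂ × ℝ) := by
    refine Prod.ext (Complex.ext ?_ ?_) ?_ <;> simp [hu]
  conv_lhs => rw [e, map_add, map_smul, map_smul, h1, h2]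
  refine Prod.ext (Complex.ext ?_ ?_) ?_ <;> simp [christoffel, eucl] <;> ring

/-- For a kernel vector `(u, σ)` the `φ`-component forces `u` to be horizontal and the vertical
component gives `σ = 0`. The horizontal components are multiplied by `1 + (1 - τ²)(k - 1)/2 = ((1 +
τ²) + k(1 - τ²))/2`, which is positive since `k ≥ 0` and `τ² ≤ 1`. -/
theorem fderiv_normalMap_injective (hS : IsConvexSurface O φ) (hN : IsNormalized O φ) {τ : ℝ}
    (hτ : τ ∈ Set.Icc (0 : ℝ) 1) (v : (ℂ × ℝ) × ℝ)
    (hv : fderiv ℝ (normalMap φ) ((0, 1), τ) v = 0) : v = 0 := by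
  obtain ⟨k₁, k₂, hk₁, hk₂, hk⟩ := exists_fderiv_unitNormal hS hN
  obtain ⟨u, σ⟩ := v
  have hline : HasDerivAt (fun s : ℝ => (((0, 1), τ) : (ℂ × ℝ) × ℝ) + s • (u, σ)) (u, σ) 0 := by
    simpa using ((hasDerivAt_id (0 : ℝ)).smul_const (u, σ)).const_add (((0, 1), τ) : (ℂ × ℝ) × ℝ)
  have h0 : (((0, 1), τ) : (ℂ × ℝ) × ℝ) = (((0, 1), τ) : (ℂ × ℝ) × ℝ) + (0 : ℝ) • (u, σ) := by
    simp
  have hF := ((contDiffAt_normalMap hS hN τ).differentiableAt (by simp)).hasFDerivAt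
  rw [h0] at hF
  have hF1 := hF.comp_hasDerivAt 0 hline
  rw [← h0, hv] at hF1
  have hline' : HasDerivAt (fun s : ℝ => ((0, 1) : ℂ × ℝ) + s • u) u 0 := by
    simpa using ((hasDerivAt_id (0 : ℝ)).smul_const u).const_add ((0, 1) : ℂ × ℝ)
  have h0' : ((0, 1) : ℂ × ℝ) = ((0, 1) : ℂ × ℝ) + (0 : ℝ) • u := by simp
  have hφ := ((hS.contDiffAt hN.mem.1).differentiableAt (by simp)).hasFDerivAt
  rw [h0'] at hφ
  have hφ1 := hφ.comp_hasDerivAt 0 hline'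
  rw [← h0'] at hφ1
  have hφ2 : HasDerivAt (fun s : ℝ => φ ((0, 1) + s • u)) 0 0 :=
    (ContinuousLinearMap.snd ℝ (ℂ × ℝ) ℝ).hasFDerivAt.comp_hasDerivAt 0 hF1
  have hu : u.2 = 0 := (fderiv_eq_zero_iff hN).1 (hφ1.unique hφ2)
  have hν := ((contDiffAt_unitNormal_base hS hN).differentiableAt (by simp)).hasFDerivAt
  rw [h0'] at hν
  have hν1 := hν.comp_hasDerivAt 0 hline'
  rw [← h0', hk u hu] at hν1
  set n : ℝ → ℂ × ℝ := unitNormal φ ∘ fun s : ℝ => ((0, 1) : ℂ × ℝ) + s • u with hn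
  have hn0 : n 0 = (0, -1) := by simp [hn, hN.normal]
  have hn1 : HasDerivAt (fun s => (n s).1) (⟨(k₁ - 1) * u.1.re, (k₂ - 1) * u.1.im⟩ : ℂ) 0 :=
    (ContinuousLinearMap.fst ℝ ℂ ℝ).hasFDerivAt.comp_hasDerivAt 0 hν1
  have hn2 : HasDerivAt (fun s => (n s).2) 0 0 :=
    (ContinuousLinearMap.snd ℝ ℂ ℝ).hasFDerivAt.comp_hasDerivAt 0 hν1
  have hT : HasDerivAt (fun s : ℝ => τ + s * σ) σ 0 := by
    simpa using ((hasDerivAt_id (0 : ℝ)).mul_const σ).const_add τ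
  -- The denominator is stationary: since the normal has vertical component `-1`, the two
  -- occurrences of `2τσ` cancel.
  have hD : HasDerivAt (fun s : ℝ => (1 + (τ + s * σ) ^ 2) - (n s).2 * (1 - (τ + s * σ) ^ 2))
      0 0 := by
    refine (((hT.pow 2).const_add 1).sub (hn2.mul ((hT.pow 2).const_sub 1))).congr_deriv ?_
    simp [hn0]
  have hD0 : (1 + (τ + 0 * σ) ^ 2) - (n 0).2 * (1 - (τ + 0 * σ) ^ 2) = 2 := by
    simp [hn0]; ring
  have hD1 : (1 + (τ + 0 * σ) ^ 2) - (n 0).2 * (1 - (τ + 0 * σ) ^ 2) ≠ 0 := by rw [hD0]; norm_num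
  have hl : HasDerivAt (fun s : ℝ => s • u.1) u.1 0 := by
    simpa using (hasDerivAt_id (0 : ℝ)).smul_const u.1
  have hG := (hl.add ((((hT.pow 2).const_sub 1).div hD hD1).smul hn1)).prodMk
    ((hT.const_mul 2).div hD hD1)
  have hG1 := hG.unique ((((ContinuousLinearMap.fst ℝ (ℂ × ℝ) ℝ).hasFDerivAt.comp_hasDerivAt 0
    hF1)).congr_of_eventuallyEq (Filter.Eventually.of_forall fun s => by
      simp [normalMap, rayPoint, hn, hu]))
  have e1 := congrArg (fun v : ℂ × ℝ => v.1.re) hG1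
  have e2 := congrArg (fun v : ℂ × ℝ => v.1.im) hG1
  have e3 := congrArg (fun v : ℂ × ℝ => v.2) hG1
  have h2 : σ = 0 := by
    simp only [hD0] at e3
    simpa using e3
  simp only [Pi.div_apply, Pi.pow_apply, hD0] at e1 e2
  simp [-Complex.real_smul, Complex.smul_re, Complex.smul_im, hn0] at e1 e2
  have hτ2 : τ ^ 2 ≤ 1 := pow_le_one₀ hτ.1 hτ.2
  have hfac : ∀ k : ℝ, 0 ≤ k → 0 < 1 + (1 - τ ^ 2) / 2 * (k - 1) := by
    intro k hk
    nlinarith [mul_nonneg hk (sub_nonneg.2 hτ2), sq_nonneg τ]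
  have hfac' : ∀ k r : ℝ, 0 ≤ k → r + (1 - τ ^ 2) / 2 * ((k - 1) * r) = 0 → r = 0 := by
    intro k r hk hr
    refine (mul_eq_zero.1 (?_ : (1 + (1 - τ ^ 2) / 2 * (k - 1)) * r = 0)).resolve_left
      (hfac k hk).ne'
    linarith
  exact Prod.ext (Prod.ext (Complex.ext (hfac' _ _ hk₁ e1) (hfac' _ _ hk₂ e2)) hu) h2

end Surface
-- Smoothness of the normal projection up to infinity
variable {O : Set (ℂ × ℝ)} {φ : ℂ × ℝ → ℝ}

/-- The tubular neighborhood of the closed normal ray on which the normal exponential map is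
inverted by a map `Θ` that is smooth along the ray, up to its end point at infinity. -/
theorem exists_normalMap_inverse (hS : IsConvexSurface O φ) (hN : IsNormalized O φ) :
    ∃ A : Set (ℂ × ℝ), IsOpen A ∧ (0, 1) ∈ A ∧
      (∀ x ∈ A, x ∈ O ∧ (unitNormal φ x).2 / x.2 < 0) ∧
      ∃ Θ : (ℂ × ℝ) × ℝ → (ℂ × ℝ) × ℝ,
        (∀ z ∈ A, ∀ τ ∈ Set.Icc (0 : ℝ) 1, Θ (normalMap φ (z, τ)) = (z, τ)) ∧
        ∀ τ ∈ Set.Icc (0 : ℝ) 1, Θ ((0, τ), 0) = ((0, 1), τ) ∧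
          ContDiffAt ℝ ∞ Θ ((0, τ), 0) ∧ ∀ᶠ y in 𝓝 ((0, τ), 0), normalMap φ (Θ y) = y := by
  have hβ : ContinuousAt (fun x : ℂ × ℝ => (unitNormal φ x).2 / x.2) (0, 1) :=
    (contDiffAt_unitNormal_base hS hN).continuousAt.snd.div continuousAt_snd (by simp)
  have hA₀ : {x : ℂ × ℝ | x ∈ O ∧ (unitNormal φ x).2 / x.2 < 0} ∈ 𝓝 ((0, 1) : ℂ × ℝ) :=
    Filter.inter_mem (hS.isOpen.mem_nhds hN.mem.1) (hβ.eventually_lt_const (by simp [hN.normal]))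
  obtain ⟨A, hAo, hA1, hA, Θ, hΘ, hΘ'⟩ := exists_inverse_near_segment (normalMap φ) (0, 1) hA₀
    (fun τ _ => contDiffAt_normalMap hS hN τ)
    (fun τ hτ => fderiv_normalMap_injective hS hN hτ)
    (fun τ _ σ _ h => by simpa [normalMap_base hN] using h)
  refine ⟨A, hAo, hA1, fun x hx => hA hx, Θ, hΘ, fun τ hτ => ?_⟩
  rw [← normalMap_base hN]
  exact ⟨hΘ _ hA1 τ hτ, hΘ' τ hτ⟩

/-- `Q q` is the end point of the normal ray from the foot point read off from `Θ (q, 0)`.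
Uniqueness of germs rests on continuity of the foot map: near the ray every competing foot point
lies in `A`, where `Θ` recovers it. -/
theorem exists_projection_chart (hS : IsConvexSurface O φ) (hN : IsNormalized O φ) :
    ∃ Q : ℂ × ℝ → ℂ, (∃ V, IsNormalProjection O φ V Q) ∧
      (∀ τ ∈ Set.Icc (0 : ℝ) 1, ContDiffAt ℝ ∞ Q (0, τ) ∧ Q (0, τ) = 0) ∧
      ∀ V P, IsNormalProjection O φ V P → ∀ t ∈ Set.Ioo (0 : ℝ) 1, P =ᶠ[𝓝 (0, t)] Q := by
  obtain ⟨A, hAo, hA1, hA, Θ, hΘ, hΘ'⟩ := exists_normalMap_inverse hS hN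
  have hι : ∀ x : ℂ × ℝ, ContDiffAt ℝ ∞ (fun q : ℂ × ℝ => (q, (0 : ℝ))) x :=
    fun x => contDiffAt_id.prodMk contDiffAt_const
  have hsm : ∀ τ ∈ Set.Icc (0 : ℝ) 1, ContDiffAt ℝ ∞ (fun q : ℂ × ℝ => Θ (q, 0)) (0, τ) :=
    fun τ hτ => (hΘ' τ hτ).2.1.comp ((0, τ) : ℂ × ℝ) (hι _)
  set foot : ℂ × ℝ → ℂ × ℝ := fun q => (Θ (q, 0)).1 with hfoot
  set Q : ℂ × ℝ → ℂ := fun q => (rayPoint (foot q) (unitNormal φ (foot q)) 0).1 with hQ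
  have hIoo : ∀ t ∈ Set.Ioo (0 : ℝ) 1, t ∈ Set.Icc (0 : ℝ) 1 := fun t ht => ⟨ht.1.le, ht.2.le⟩
  refine ⟨Q, ?_, ?_, ?_⟩
  -- Each condition holds near every point of the open ray, so the interior of `W` still contains
  -- the ray. The last condition places the foot on the surface and `q` on its normal ray.
  · set W : Set (ℂ × ℝ) := {q | 0 < q.2 ∧ ContinuousAt foot q ∧ foot q ∈ A ∧
      (Θ (q, 0)).2 ∈ Set.Ioo (0 : ℝ) 1 ∧ normalMap φ (Θ (q, 0)) = (q, 0)} with hW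
    have hWi : interior W ⊆ W := interior_subset
    have hWm : ∀ t ∈ Set.Ioo (0 : ℝ) 1, ((0, t) : ℂ × ℝ) ∈ interior W := by
      intro t ht
      obtain ⟨h1, h2, h3⟩ := hΘ' t (hIoo t ht)
      have hs := hsm t (hIoo t ht)
      rw [mem_interior_iff_mem_nhds]
      have c1 : ∀ᶠ q : ℂ × ℝ in 𝓝 (0, t), 0 < q.2 :=
        continuousAt_snd.eventually_const_lt ht.1
      have c2 : ∀ᶠ q : ℂ × ℝ in 𝓝 (0, t), ContinuousAt foot q :=
        ((hs.of_le (m := 1) (by simp)).eventually (by simp)).mono fun q hq =>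
          hq.continuousAt.fst
      have c3 : ∀ᶠ q : ℂ × ℝ in 𝓝 (0, t), foot q ∈ A :=
        hs.continuousAt.fst.eventually_mem (hAo.mem_nhds (by simpa [h1] using hA1))
      have c4 : ∀ᶠ q : ℂ × ℝ in 𝓝 (0, t), (Θ (q, 0)).2 ∈ Set.Ioo (0 : ℝ) 1 :=
        hs.continuousAt.snd.eventually_mem (isOpen_Ioo.mem_nhds (by simpa [h1] using ht))
      have c5 : ∀ᶠ q : ℂ × ℝ in 𝓝 (0, t), normalMap φ (Θ (q, 0)) = (q, 0) :=
        (hι (0, t)).continuousAt.eventually h3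
      filter_upwards [c1, c2, c3, c4, c5] with q d1 d2 d3 d4 d5
      exact ⟨d1, d2, d3, d4, d5⟩
    refine ⟨interior W, isOpen_interior, fun q hq => (hWi hq).1, hWm, foot,
      fun q hq => (hWi hq).2.1.continuousWithinAt, fun t ht => ?_, fun q hq => ?_⟩
    · simp [hfoot, (hΘ' t (hIoo t ht)).1]
    · obtain ⟨d1, d2, d3, d4, d5⟩ := hWi hq
      have d6 := congrArg Prod.fst d5
      refine ⟨⟨(hA _ d3).1, congrArg Prod.snd d5⟩,
        ⟨-Real.log (Θ (q, 0)).2, neg_pos.2 (Real.log_neg d4.1 d4.2), ?_⟩,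
        tendsto_geodesic _ _ (hA _ d3).2⟩
      rw [geodesic_eq_rayPoint, neg_neg, Real.exp_log d4.1]
      exact d6
  · intro τ hτ
    have h1 : foot (0, τ) = (0, 1) := by simp [hfoot, (hΘ' τ hτ).1]
    constructor
    · have hf : ContDiffAt ℝ ∞ foot (0, τ) := (hsm τ hτ).fst
      -- The end point is the horizontal part of `normalMap` at `τ = 0`, so its smooth dependence on
      -- the foot point is already known.
      have hr : ContDiffAt ℝ ∞ (fun a : ℂ × ℝ => (normalMap φ (a, 0)).1.1) (foot (0, τ)) := by
        rw [h1]
        exact ((contDiffAt_normalMap hS hN 0).comp ((0, 1) : ℂ × ℝ) (hι _)).fst.fst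
      exact hr.comp _ hf
    · simp [hQ, h1, rayPoint, hN.normal]
  · rintro V P ⟨hVo, hVu, hV, foot', hc, hf0, hft⟩ t ht
    have hVn : V ∈ 𝓝 ((0, t) : ℂ × ℝ) := hVo.mem_nhds (hV t ht)
    have hcA : ∀ᶠ q in 𝓝 ((0, t) : ℂ × ℝ), foot' q ∈ A :=
      (hc.continuousAt hVn).eventually_mem (hAo.mem_nhds (by simpa [hf0 t ht] using hA1))
    filter_upwards [hVn, hcA] with q hq hqA
    obtain ⟨⟨-, hφ0⟩, ⟨r, hr, hrq⟩, hlim⟩ := hft q hq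
    have hτ : Real.exp (-r) ∈ Set.Icc (0 : ℝ) 1 :=
      ⟨(Real.exp_pos _).le, Real.exp_le_one_iff.2 (by linarith)⟩
    have hm : normalMap φ (foot' q, Real.exp (-r)) = (q, 0) := by
      rw [normalMap, ← geodesic_eq_rayPoint, hrq, hφ0]
    have hΘq := hΘ _ hqA _ hτ
    rw [hm] at hΘq
    have hfq : foot q = foot' q := by simp [hfoot, hΘq]
    have := tendsto_nhds_unique hlim (tendsto_geodesic _ _ (hA _ hqA).2)
    simpa [hQ, hfq] using congrArg Prod.fst this

/-! ### The derivative of the canonical lift -/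

/-- The projective vector field `(z - w)² ∂/∂z`. -/
def squareField (w : ℂ) : ProjField := ![w ^ 2, -2 * w, 1]

theorem contDiff_canonicalLift {f : ℂ → ℂ} (hf : Differentiable ℂ f) :
    ContDiff ℂ ∞ (canonicalLift f) := by
  have h0 : ContDiff ℂ ∞ f := hf.contDiff
  have h1 : ContDiff ℂ ∞ (deriv f) := hf.deriv.contDiff
  have h2 : ContDiff ℂ ∞ (deriv (deriv f)) := hf.deriv.deriv.contDiff
  rw [contDiff_pi]
  intro i
  fin_cases i
  · exact (h0.sub (h1.mul contDiff_id)).add ((h2.div_const 2).mul (contDiff_id.pow 2))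
  · exact h1.sub (h2.mul contDiff_id)
  · exact h2.div_const 2

/-- Differentiating a Taylor polynomial in its base point telescopes: only the term with the third
derivative remains. -/
theorem hasDerivAt_canonicalLift {f : ℂ → ℂ} (hf : Differentiable ℂ f) (w : ℂ) :
    HasDerivAt (canonicalLift f) ((deriv (deriv (deriv f)) w / 2) • squareField w) w := by
  have h0 := (hf w).hasDerivAt
  have h1 := (hf.deriv w).hasDerivAt
  have h2 := (hf.deriv.deriv w).hasDerivAt
  have hid := hasDerivAt_id w
  rw [hasDerivAt_pi]
  intro i
  fin_cases i
  · refine ((h0.sub (h1.mul hid)).add ((h2.div_const 2).mul (hid.pow 2))).congr_deriv ?_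
    simp [squareField]
    ring
  · refine (h1.sub (h2.mul hid)).congr_deriv ?_
    simp [squareField]
    ring
  · refine (h2.div_const 2).congr_deriv ?_
    simp [squareField]

theorem hasFDerivAt_canonicalLift_comp {f : ℂ → ℂ} (hf : Differentiable ℂ f) {Q : ℂ × ℝ → ℂ}
    {x : ℂ × ℝ} (hQ : DifferentiableAt ℝ Q x) :
    HasFDerivAt (fun q => canonicalLift f (Q q))
      ((fderiv ℝ Q x).smulRight ((deriv (deriv (deriv f)) (Q x) / 2) • squareField (Q x))) x := by
  refine (((hasDerivAt_canonicalLift hf (Q x)).hasFDerivAt.restrictScalars ℝ).comp x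
    hQ.hasFDerivAt).congr_fderiv ?_
  refine ContinuousLinearMap.ext fun v => ?_
  simp

/-! ### The fibre metric and its dual -/

/-- The real linear form `q ↦ Re (z * conj (q k))`, as a function of `z`. -/
noncomputable def coordForm (k : Fin 3) : ℂ →L[ℝ] (ProjField →L[ℝ] ℝ) :=
  (ContinuousLinearMap.compL ℝ ProjField ℂ ℝ Complex.reCLM).comp
    (((ContinuousLinearMap.compL ℝ ProjField ℂ ℂ).flip
      (Complex.conjCLE.toContinuousLinearMap.comp (ContinuousLinearMap.proj k))).comp
        (ContinuousLinearMap.mul ℝ ℂ))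

theorem coordForm_apply (k : Fin 3) (z : ℂ) (q : ProjField) :
    coordForm k z q = (z * conj (q k)).re := rfl

theorem sharp_apply (x : ℂ × ℝ) (p q : ProjField) : sharp x p q = fiberInner x p q := rfl

/-- The fibre inner product at `(w, t)`, in terms of the 2-jets at `w`. -/
theorem fiberInner_eq (x : ℂ × ℝ) (hx : x.2 ≠ 0) (p q : ProjField) :
    fiberInner x p q = (2 * (p.eval x.1 * conj (q.eval x.1)) / (x.2 : ℂ) ^ 2 +
      (p 1 + 2 * p 2 * x.1) * conj (q 1 + 2 * q 2 * x.1) +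
        2 * (x.2 : ℂ) ^ 2 * (p 2 * conj (q 2))).re := by
  have hI : ∀ r : ProjField, (Complex.I • r).eval x.1 = Complex.I * r.eval x.1 := by
    intro r; simp [ProjField.eval]; ring
  have hB : ∀ r : ProjField, (Complex.I • r) 1 + 2 * (Complex.I • r) 2 * x.1 =
      Complex.I * (r 1 + 2 * r 2 * x.1) := by
    intro r; simp; ring
  simp only [fiberInner, metric, eucl, killing, hI, hB]
  generalize p.eval x.1 = A
  generalize q.eval x.1 = A'
  generalize p 1 + 2 * p 2 * x.1 = B
  generalize q 1 + 2 * q 2 * x.1 = B'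
  rw [← Complex.ofReal_pow]
  simp [-Complex.ofReal_pow, Complex.div_ofReal_re]
  field_simp
  ring

theorem squareField_eval (z w y : ℂ) : (z • squareField w).eval y = z * (y - w) ^ 2 := by
  simp [squareField, ProjField.eval]
  ring

/-- Expansion in forms independent of `y`, so that differentiation in `y` acts on scalar
coefficients only. All terms but the last contain the factor `y.1 - w`. -/
theorem sharp_smul_squareField (y : ℂ × ℝ) (hy : y.2 ≠ 0) (z w : ℂ) :
    sharp y (z • squareField w) =
      coordForm 0 (2 * z * (y.1 - w) ^ 2 / (y.2 : ℂ) ^ 2) +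
      coordForm 1 (2 * z * (y.1 - w) ^ 2 * conj y.1 / (y.2 : ℂ) ^ 2 + 2 * z * (y.1 - w)) +
      coordForm 2 (2 * z * (y.1 - w) ^ 2 * conj y.1 ^ 2 / (y.2 : ℂ) ^ 2 +
        4 * z * (y.1 - w) * conj y.1 + 2 * (y.2 : ℂ) ^ 2 * z) := by
  ext q
  rw [sharp_apply, fiberInner_eq y hy, squareField_eval]
  simp only [_root_.add_apply, coordForm_apply, ← Complex.add_re]
  congr 1
  have h2 : conj (2 : ℂ) = 2 := map_ofNat _ 2
  simp [squareField, ProjField.eval, h2]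
  ring

theorem sharp_axis {t : ℝ} (ht : t ≠ 0) (b c : ℂ) :
    sharp (0, t) ![0, b, c] = coordForm 1 b + coordForm 2 (2 * (t : ℂ) ^ 2 * c) := by
  ext q
  rw [sharp_apply, fiberInner_eq (0, t) ht]
  simp only [_root_.add_apply, coordForm_apply, ← Complex.add_re]
  congr 1
  simp [ProjField.eval]
  ring

/-- On the axis the `z²`-coefficient is weighted by `√2 t` in the norm, and the `z`-coefficient by
`1`. The constant coefficient, whose weight would be of order `t⁻¹`, is absent in all uses. -/
theorem fiberInner_axis {t : ℝ} (ht : t ≠ 0) (b c : ℂ) :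
    fiberInner (0, t) ![0, b, c] ![0, b, c] = ‖b‖ ^ 2 + 2 * t ^ 2 * ‖c‖ ^ 2 := by
  rw [fiberInner_eq (0, t) ht]
  simp [ProjField.eval, Complex.mul_conj, Complex.normSq_eq_norm_sq]
  norm_cast
  simp

theorem flat_eq {x : ℂ × ℝ} (hx : x ∈ upperHalf) {p : ProjField} {l : ProjField →L[ℝ] ℝ}
    (h : sharp x p = l) : flat x l = p := by
  rw [← h]
  exact Function.leftInverse_invFun (sharp_bijective x hx).1 p

/-! ### The codifferential on the axis -/

section Codifferential

variable {E : Type*} [NormedAddCommGroup E] [NormedSpace ℝ E]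

theorem hasFDerivAt_mul_of_zero {F k : E → ℂ} {x : E} (hF : HasFDerivAt F (0 : E →L[ℝ] ℂ) x) (h0 : F x = 0)
    (hk : DifferentiableAt ℝ k x) : HasFDerivAt (fun y => F y * k y) (0 : E →L[ℝ] ℂ) x := by
  refine (hF.mul hk.hasFDerivAt).congr_fderiv ?_
  refine ContinuousLinearMap.ext fun v => ?_
  simp [h0]

theorem hasFDerivAt_mul_zero_zero {D k : E → ℂ} {x : E} (hD : DifferentiableAt ℝ D x)
    (hk : DifferentiableAt ℝ k x) (h0 : D x = 0) (h1 : k x = 0) :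
    HasFDerivAt (fun y => D y * k y) (0 : E →L[ℝ] ℂ) x := by
  refine (hD.hasFDerivAt.mul hk.hasFDerivAt).congr_fderiv ?_
  refine ContinuousLinearMap.ext fun v => ?_
  simp [h0, h1]

/-- Both `y.1 - Q y` and `conj y.1` vanish on the axis, so terms with two such factors have zero
derivative there. Only the term linear in `y.1 - Q y` and the one free of it contribute. -/
theorem fderiv_inv_smul_sharp {t : ℝ} (ht : 0 < t) {g Q : ℂ × ℝ → ℂ} {g' Q' : ℂ × ℝ →L[ℝ] ℂ}
    (hg : HasFDerivAt g g' (0, t)) (hQ : HasFDerivAt Q Q' (0, t)) (hQ0 : Q (0, t) = 0)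
    (v : ℂ × ℝ) :
    fderiv ℝ (fun y : ℂ × ℝ => y.2⁻¹ • sharp y (g y • squareField (Q y))) (0, t) v =
      coordForm 1 (2 * (t : ℂ)⁻¹ * g (0, t) * (v.1 - Q' v)) +
        coordForm 2 (2 * t * g' v + 2 * v.2 * g (0, t)) := by
  have htc : (t : ℂ) ≠ 0 := by exact_mod_cast ht.ne'
  have hT : HasFDerivAt (fun y : ℂ × ℝ => (y.2 : ℂ))
      (Complex.ofRealCLM.comp (ContinuousLinearMap.snd ℝ ℂ ℝ)) (0, t) :=
    (Complex.ofRealCLM.comp (ContinuousLinearMap.snd ℝ ℂ ℝ)).hasFDerivAt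
  have hTi : DifferentiableAt ℝ (fun y : ℂ × ℝ => ((y.2 : ℂ))⁻¹) (0, t) :=
    hT.differentiableAt.fun_inv htc
  have hc : DifferentiableAt ℝ (fun y : ℂ × ℝ => conj y.1) (0, t) :=
    (Complex.conjCLE.toContinuousLinearMap.comp
      (ContinuousLinearMap.fst ℝ ℂ ℝ)).differentiableAt
  set D : ℂ × ℝ → ℂ := fun y => y.1 - Q y with hD
  have hD' : HasFDerivAt D (ContinuousLinearMap.fst ℝ ℂ ℝ - Q') (0, t) :=
    hasFDerivAt_fst.sub hQ
  have hD0 : D (0, t) = 0 := by simp [hD, hQ0]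
  have hDD : HasFDerivAt (fun y => D y * D y) (0 : ℂ × ℝ →L[ℝ] ℂ) (0, t) :=
    hasFDerivAt_mul_zero_zero hD'.differentiableAt hD'.differentiableAt hD0 hD0
  have hDc : HasFDerivAt (fun y => D y * conj y.1) (0 : ℂ × ℝ →L[ℝ] ℂ) (0, t) :=
    hasFDerivAt_mul_zero_zero hD'.differentiableAt hc hD0 (by simp)
  have hg1 := hg.differentiableAt
  have a0 : HasFDerivAt (fun y : ℂ × ℝ => D y * D y * (2 * g y * (y.2 : ℂ)⁻¹ ^ 3))
      (0 : ℂ × ℝ →L[ℝ] ℂ) (0, t) :=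
    hasFDerivAt_mul_of_zero hDD (by simp [hD0]) (by fun_prop)
  have a1 : HasFDerivAt (fun y : ℂ × ℝ => D y * D y * (2 * g y * (y.2 : ℂ)⁻¹ ^ 3 * conj y.1) +
      2 * g y * (y.2 : ℂ)⁻¹ * D y)
      ((2 * g (0, t) * (t : ℂ)⁻¹) • (ContinuousLinearMap.fst ℝ ℂ ℝ - Q')) (0, t) := by
    have hk : DifferentiableAt ℝ (fun y : ℂ × ℝ => 2 * g y * (y.2 : ℂ)⁻¹) (0, t) := by fun_prop
    refine ((hasFDerivAt_mul_of_zero hDD (by simp [hD0]) (by fun_prop)).add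
      (hk.hasFDerivAt.mul hD')).congr_fderiv ?_
    simp [hD0]
  have a2 : HasFDerivAt (fun y : ℂ × ℝ =>
      D y * D y * (2 * g y * (y.2 : ℂ)⁻¹ ^ 3 * conj y.1 ^ 2) +
      D y * conj y.1 * (4 * g y * (y.2 : ℂ)⁻¹) + 2 * ((y.2 : ℂ) * g y))
      ((2 : ℂ) • ((t : ℂ) • g' +
        g (0, t) • Complex.ofRealCLM.comp (ContinuousLinearMap.snd ℝ ℂ ℝ))) (0, t) := by
    refine (((hasFDerivAt_mul_of_zero hDD (by simp [hD0]) (by fun_prop)).add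
      (hasFDerivAt_mul_of_zero hDc (by simp [hD0]) (by fun_prop))).add
      ((hT.mul hg).const_mul 2)).congr_fderiv ?_
    simp
  have hsum := (((coordForm 0).hasFDerivAt.comp _ a0).add ((coordForm 1).hasFDerivAt.comp _ a1)).add
    ((coordForm 2).hasFDerivAt.comp _ a2)
  have heq : (fun y : ℂ × ℝ => y.2⁻¹ • sharp y (g y • squareField (Q y))) =ᶠ[𝓝 (0, t)]
      fun y : ℂ × ℝ => coordForm 0 (D y * D y * (2 * g y * (y.2 : ℂ)⁻¹ ^ 3)) +
        coordForm 1 (D y * D y * (2 * g y * (y.2 : ℂ)⁻¹ ^ 3 * conj y.1) +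
          2 * g y * (y.2 : ℂ)⁻¹ * D y) +
        coordForm 2 (D y * D y * (2 * g y * (y.2 : ℂ)⁻¹ ^ 3 * conj y.1 ^ 2) +
          D y * conj y.1 * (4 * g y * (y.2 : ℂ)⁻¹) + 2 * ((y.2 : ℂ) * g y)) := by
    have hpos : ∀ᶠ y : ℂ × ℝ in 𝓝 (0, t), 0 < y.2 := continuousAt_snd.eventually_const_lt ht
    filter_upwards [hpos] with y hy
    have hy' : (y.2 : ℂ) ≠ 0 := by exact_mod_cast hy.ne'
    rw [sharp_smul_squareField y hy.ne', smul_add, smul_add, ← map_smul, ← map_smul, ← map_smul]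
    simp only [Complex.real_smul, hD, Complex.ofReal_inv]
    congr 1
    · congr 1
      · congr 1
        field_simp
      · congr 1
        field_simp
    · congr 1
      field_simp
  rw [(hsum.congr_of_eventuallyEq heq).fderiv]
  simp
  congr 2
  · ring
  · exact congrArg (coordForm 2) (by ring)
  · exact congrArg (coordForm 2) (by ring)

/-- No constant coefficient appears, the `z`-coefficient carries `t²`, and the `z²`-coefficient
carries `t`. By `fiberInner_axis` these powers give a norm of order `t²` once the remaining factors
are bounded. -/
theorem codiff_axis {t : ℝ} (ht : 0 < t) {α : ℂ × ℝ → (ℂ × ℝ →L[ℝ] ProjField)}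
    {g : Fin 3 → ℂ × ℝ → ℂ} {Q : ℂ × ℝ → ℂ} {g' : Fin 3 → ℂ × ℝ →L[ℝ] ℂ} {Q' : ℂ × ℝ →L[ℝ] ℂ}
    (hg : ∀ i, HasFDerivAt (g i) (g' i) (0, t)) (hQ : HasFDerivAt Q Q' (0, t))
    (hQ0 : Q (0, t) = 0)
    (hα : ∀ i, (fun y => α y (coordVec i)) =ᶠ[𝓝 (0, t)] fun y => g i y • squareField (Q y)) :
    codiff α (0, t) = ![0,
      -(2 * (t : ℂ) ^ 2 * ∑ i, g i (0, t) * ((coordVec i).1 - Q' (coordVec i))),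
      -((t : ℂ) ^ 2 * ∑ i, g' i (coordVec i) + t * ∑ i, (coordVec i).2 * g i (0, t))] := by
  have htc : (t : ℂ) ≠ 0 := by exact_mod_cast ht.ne'
  have h1 : ∀ i, fderiv ℝ (fun y : ℂ × ℝ => y.2⁻¹ • sharp y (α y (coordVec i))) (0, t)
      (coordVec i) = coordForm 1 (2 * (t : ℂ)⁻¹ * g i (0, t) * ((coordVec i).1 - Q' (coordVec i)))
        + coordForm 2 (2 * t * g' i (coordVec i) + 2 * (coordVec i).2 * g i (0, t)) := by
    intro i
    rw [← fderiv_inv_smul_sharp ht (hg i) hQ hQ0]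
    refine congrArg (fun l : ℂ × ℝ →L[ℝ] (ProjField →L[ℝ] ℝ) => l (coordVec i))
      (Filter.EventuallyEq.fderiv_eq ?_)
    filter_upwards [hα i] with y hy
    rw [hy]
  rw [codiff, neg_eq_iff_eq_neg]
  refine flat_eq (show (0 : ℝ) < _ from ht) ?_
  have h2 : ∀ b c : ℂ, -(![0, -b, -c] : ProjField) = ![0, b, c] := by
    intro b c; ext i; fin_cases i <;> simp
  rw [h2, sharp_axis ht.ne', Finset.sum_congr rfl fun i _ => h1 i, Finset.sum_add_distrib,
    ← map_sum, ← map_sum, smul_add, ← map_smul, ← map_smul]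
  congr 2
  · simp only [Finset.mul_sum, Finset.smul_sum]
    refine Finset.sum_congr rfl fun i _ => ?_
    simp
    field_simp
  · rw [mul_add, Finset.sum_add_distrib, smul_add]
    simp only [Finset.mul_sum, Finset.smul_sum]
    congr 1 <;>
    · refine Finset.sum_congr rfl fun i _ => ?_
      simp
      ring

end Codifferential

/-! ### The divergence of the real part -/

/-- Killing fields have divergence zero, so the divergence of the real part of a section `s` only
depends on `ds`. -/
theorem divergence_realPart {s : ℂ × ℝ → ProjField} {y : ℂ × ℝ} (hy : y.2 ≠ 0)
    (hs : DifferentiableAt ℝ s y) : divergence (realPart s) y =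
      ∑ i, eucl (killing (fderiv ℝ s y (coordVec i)) y) (coordVec i) := by
  have hs' : ∀ i, HasFDerivAt (fun y => s y i)
      ((ContinuousLinearMap.proj (R := ℝ) (φ := fun _ : Fin 3 => ℂ) i).comp (fderiv ℝ s y)) y :=
    hasFDerivAt_pi'.1 hs.hasFDerivAt
  have hT : HasFDerivAt (fun y : ℂ × ℝ => (y.2 : ℂ))
      (Complex.ofRealCLM.comp (ContinuousLinearMap.snd ℝ ℂ ℝ)) y :=
    (Complex.ofRealCLM.comp (ContinuousLinearMap.snd ℝ ℂ ℝ)).hasFDerivAt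
  have hw : HasFDerivAt (fun y : ℂ × ℝ => y.1) (ContinuousLinearMap.fst ℝ ℂ ℝ) y := hasFDerivAt_fst
  have ht : HasFDerivAt (fun y : ℂ × ℝ => y.2) (ContinuousLinearMap.snd ℝ ℂ ℝ) y := hasFDerivAt_snd
  have hc : HasFDerivAt (fun y => conj (s y 2)) _ y :=
    Complex.conjCLE.toContinuousLinearMap.hasFDerivAt.comp y (hs' 2)
  have h1 := (((hs' 0).add ((hs' 1).mul hw)).add ((hs' 2).mul (hw.pow 2))).sub ((hT.pow 2).mul hc)
  have h2 := ht.mul (Complex.reCLM.hasFDerivAt.comp y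
    ((hs' 1).add (((hs' 2).const_mul 2).mul hw)))
  have h3 : HasFDerivAt (realPart s) _ y := h1.prodMk h2
  simp only [divergence, covDeriv, h3.fderiv]
  simp [Fin.sum_univ_three, metric, eucl, christoffel, frame, coordVec, realPart, killing,
    ProjField.eval, ← Complex.ofReal_pow, -Complex.real_smul, Complex.smul_re, Complex.smul_im]
  field_simp
  ring

/-- The formula is needed off the axis as well, because the divergence is differentiated afterwards.
-/
theorem divergence_smul_squareField {s : ℂ × ℝ → ProjField} {y : ℂ × ℝ} (hy : y.2 ≠ 0)
    (hs : DifferentiableAt ℝ s y) {g : Fin 3 → ℂ} {w : ℂ}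
    (hg : ∀ i, fderiv ℝ s y (coordVec i) = g i • squareField w) :
    divergence (realPart s) y =
      ((y.1 - w) * (y.1 - w) * g 0 - (y.2 : ℂ) ^ 2 * conj (g 0)).re +
      ((y.1 - w) * (y.1 - w) * g 1 - (y.2 : ℂ) ^ 2 * conj (g 1)).im +
      y.2 * (2 * g 2 * (y.1 - w)).re := by
  simp only [divergence_realPart hy hs, hg, killing, squareField_eval, Fin.sum_univ_three, eucl]
  simp [coordVec, squareField, pow_two]
  ring

/-- Continuity is required at `t = 0` itself; smoothness of `Q` at the end point of the ray enters
the estimates through this. -/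
theorem isBigO_sq_of_eq_sq_mul {F H : ℝ → ℝ} (hF : ∀ᶠ t in 𝓝[>] (0 : ℝ), F t = t ^ 2 * H t)
    (hH : ContinuousAt H 0) : F =O[𝓝[>] 0] (fun t : ℝ => t ^ 2) := by
  have h1 : H =O[𝓝[>] 0] (fun _ => (1 : ℝ)) :=
    (hH.tendsto.mono_left nhdsWithin_le_nhds).isBigO_one ℝ
  have h2 := (isBigO_refl (fun t : ℝ => t ^ 2) (𝓝[>] 0)).mul h1
  simp only [mul_one] at h2
  exact h2.congr' (hF.mono fun t ht => ht.symm) Filter.EventuallyEq.rfl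

/-- The squares of `y.1 - Q y` drop out, and every remaining term has a factor `t`. Evaluation on
the frame `t ∂ⱼ` yields the other one. -/
theorem fderiv_divergence_model {t : ℝ} {g : Fin 3 → ℂ × ℝ → ℂ} {Q : ℂ × ℝ → ℂ}
    {g' : Fin 3 → ℂ × ℝ →L[ℝ] ℂ} {Q' : ℂ × ℝ →L[ℝ] ℂ}
    (hg : ∀ i, HasFDerivAt (g i) (g' i) (0, t)) (hQ : HasFDerivAt Q Q' (0, t))
    (hQ0 : Q (0, t) = 0) (v : ℂ × ℝ) :
    fderiv ℝ (fun y : ℂ × ℝ =>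
      ((y.1 - Q y) * (y.1 - Q y) * g 0 y - (y.2 : ℂ) ^ 2 * conj (g 0 y)).re +
      ((y.1 - Q y) * (y.1 - Q y) * g 1 y - (y.2 : ℂ) ^ 2 * conj (g 1 y)).im +
      y.2 * (2 * g 2 y * (y.1 - Q y)).re) (0, t) v =
    -(2 * t * v.2) * ((g 0 (0, t)).re - (g 1 (0, t)).im) -
      t ^ 2 * ((g' 0 v).re - (g' 1 v).im) + t * (2 * g 2 (0, t) * (v.1 - Q' v)).re := by
  have hT : HasFDerivAt (fun y : ℂ × ℝ => (y.2 : ℂ))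
      (Complex.ofRealCLM.comp (ContinuousLinearMap.snd ℝ ℂ ℝ)) (0, t) :=
    (Complex.ofRealCLM.comp (ContinuousLinearMap.snd ℝ ℂ ℝ)).hasFDerivAt
  have ht : HasFDerivAt (fun y : ℂ × ℝ => y.2) (ContinuousLinearMap.snd ℝ ℂ ℝ) (0, t) :=
    hasFDerivAt_snd
  have hD : HasFDerivAt (fun y : ℂ × ℝ => y.1 - Q y) (ContinuousLinearMap.fst ℝ ℂ ℝ - Q') (0, t) :=
    hasFDerivAt_fst.sub hQ
  have hDD : HasFDerivAt (fun y : ℂ × ℝ => (y.1 - Q y) * (y.1 - Q y)) (0 : ℂ × ℝ →L[ℝ] ℂ) (0, t) :=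
    hasFDerivAt_mul_zero_zero hD.differentiableAt hD.differentiableAt (by simp [hQ0])
      (by simp [hQ0])
  have hk : ∀ i, HasFDerivAt (fun y : ℂ × ℝ =>
      (y.1 - Q y) * (y.1 - Q y) * g i y - (y.2 : ℂ) ^ 2 * conj (g i y)) _ (0, t) := fun i =>
    (hasFDerivAt_mul_of_zero hDD (by simp [hQ0]) (hg i).differentiableAt).sub ((hT.pow 2).mul
      (Complex.conjCLE.toContinuousLinearMap.hasFDerivAt.comp _ (hg i)))
  have h := ((Complex.reCLM.hasFDerivAt.comp _ (hk 0)).add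
    (Complex.imCLM.hasFDerivAt.comp _ (hk 1))).add
      (ht.mul (Complex.reCLM.hasFDerivAt.comp _ (((hg 2).const_mul 2).mul hD)))
  refine (congrArg (fun l : ℂ × ℝ →L[ℝ] ℝ => l v) h.fderiv).trans ?_
  simp [hQ0, ← Complex.ofReal_pow]
  ring

/-! ### The four estimates -/

/-- The estimates for a section that is the canonical lift along a map which is smooth up to the
end point of the ray `{(0, t) : 0 < t < 1}` and vanishes on the ray. -/
theorem estimates_of_chart {f : ℂ → ℂ} (hf : Differentiable ℂ f) {Q : ℂ × ℝ → ℂ}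
    (hQ : ∀ t ∈ Set.Icc (0 : ℝ) 1, ContDiffAt ℝ ∞ Q (0, t) ∧ Q (0, t) = 0)
    {s : ℂ × ℝ → ProjField}
    (hs : ∀ t ∈ Set.Ioo (0 : ℝ) 1, s =ᶠ[𝓝 (0, t)] fun q => canonicalLift f (Q q)) :
    (∀ t ∈ Set.Ioo (0 : ℝ) 1, ContDiffAt ℝ ∞ s (0, t)) ∧
      (fun t : ℝ => formNorm (0, t) (extD s (0, t))) =O[𝓝[>] 0] (fun t : ℝ => t ^ 2) ∧
      (fun t : ℝ => fiberNorm (0, t) (laplacian s (0, t))) =O[𝓝[>] 0] (fun t : ℝ => t ^ 2) ∧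
      (fun t : ℝ => divergence (realPart s) (0, t)) =O[𝓝[>] 0] (fun t : ℝ => t ^ 2) ∧
      (fun t : ℝ => normDiff (divergence (realPart s)) (0, t))
        =O[𝓝[>] 0] (fun t : ℝ => t ^ 2) := by
  have hIoo : ∀ t ∈ Set.Ioo (0 : ℝ) 1, t ∈ Set.Icc (0 : ℝ) 1 := fun t ht => ⟨ht.1.le, ht.2.le⟩
  -- These are the coefficients in `ds(∂ᵢ) = gᵢ (z - Q)² ∂/∂z`. They are smooth at `(0, t)` even for
  -- `t = 0`.
  set g : Fin 3 → ℂ × ℝ → ℂ := fun i x =>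
    fderiv ℝ Q x (coordVec i) * (deriv (deriv (deriv f)) (Q x) / 2) with hg
  have hdQ : ∀ t ∈ Set.Icc (0 : ℝ) 1, ContDiffAt ℝ ∞ (fderiv ℝ Q) (0, t) := fun t ht =>
    (hQ t ht).1.fderiv_right (by simp)
  have hgs : ∀ t ∈ Set.Icc (0 : ℝ) 1, ∀ i, ContDiffAt ℝ ∞ (g i) (0, t) := by
    intro t ht i
    have h3 : ContDiff ℂ ∞ (deriv (deriv (deriv f))) := hf.deriv.deriv.deriv.contDiff
    exact ((hdQ t ht).clm_apply contDiffAt_const).mul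
      (((h3.restrict_scalars ℝ).contDiffAt.comp _ (hQ t ht).1).div_const 2)
  have hgd : ∀ t ∈ Set.Icc (0 : ℝ) 1, ∀ i, HasFDerivAt (g i) (fderiv ℝ (g i) (0, t)) (0, t) :=
    fun t ht i => ((hgs t ht i).differentiableAt (by simp)).hasFDerivAt
  have hQd : ∀ t ∈ Set.Icc (0 : ℝ) 1, HasFDerivAt Q (fderiv ℝ Q (0, t)) (0, t) :=
    fun t ht => ((hQ t ht).1.differentiableAt (by simp)).hasFDerivAt
  have hds : ∀ t ∈ Set.Ioo (0 : ℝ) 1, ∀ᶠ y : ℂ × ℝ in 𝓝 (0, t), y.2 ≠ 0 ∧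
      DifferentiableAt ℝ s y ∧ ∀ i, fderiv ℝ s y (coordVec i) = g i y • squareField (Q y) := by
    intro t ht
    have h1 : ∀ᶠ y : ℂ × ℝ in 𝓝 (0, t), 0 < y.2 := continuousAt_snd.eventually_const_lt ht.1
    have h2 : ∀ᶠ y in 𝓝 (0, t), ContDiffAt ℝ 1 Q y :=
      ((hQ t (hIoo t ht)).1.of_le (m := 1) (by simp)).eventually (by simp)
    filter_upwards [h1, h2, (hs t ht).eventuallyEq_nhds] with y hy hQy hsy
    have h3 := (hasFDerivAt_canonicalLift_comp hf
      (hQy.differentiableAt (by simp))).congr_of_eventuallyEq hsy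
    refine ⟨hy.ne', h3.differentiableAt, fun i => ?_⟩
    rw [h3.fderiv, ContinuousLinearMap.smulRight_apply]
    ext j
    simp [hg]
    ring
  have hev : ∀ᶠ t in 𝓝[>] (0 : ℝ), t ∈ Set.Ioo (0 : ℝ) 1 := Ioo_mem_nhdsGT one_pos
  have h0 : (0 : ℝ) ∈ Set.Icc (0 : ℝ) 1 := by simp
  have hax : ContinuousAt (fun t : ℝ => ((0, t) : ℂ × ℝ)) 0 := by fun_prop
  have cg : ∀ i, ContinuousAt (fun t : ℝ => g i (0, t)) 0 := fun i =>
    ContinuousAt.comp (f := fun t : ℝ => ((0, t) : ℂ × ℝ)) (hgs 0 h0 i).continuousAt hax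
  have cg' : ∀ i v, ContinuousAt (fun t : ℝ => fderiv ℝ (g i) (0, t) v) 0 := fun i v =>
    (ContinuousAt.comp (f := fun t : ℝ => ((0, t) : ℂ × ℝ))
      ((hgs 0 h0 i).fderiv_right (m := 0) (by simp)).continuousAt hax).clm_apply continuousAt_const
  have cQ : ∀ v, ContinuousAt (fun t : ℝ => fderiv ℝ Q (0, t) v) 0 := fun v =>
    (ContinuousAt.comp (f := fun t : ℝ => ((0, t) : ℂ × ℝ))
      (hdQ 0 h0).continuousAt hax).clm_apply continuousAt_const
  have hdiv : ∀ t ∈ Set.Ioo (0 : ℝ) 1, divergence (realPart s) =ᶠ[𝓝 (0, t)] fun y : ℂ × ℝ =>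
      ((y.1 - Q y) * (y.1 - Q y) * g 0 y - (y.2 : ℂ) ^ 2 * conj (g 0 y)).re +
      ((y.1 - Q y) * (y.1 - Q y) * g 1 y - (y.2 : ℂ) ^ 2 * conj (g 1 y)).im +
      y.2 * (2 * g 2 y * (y.1 - Q y)).re := by
    intro t ht
    filter_upwards [hds t ht] with y hy
    exact divergence_smul_squareField (g := fun i => g i y) hy.1 hy.2.1 hy.2.2
  refine ⟨fun t ht => ?_, ?_, ?_, ?_, ?_⟩
  · exact (((contDiff_canonicalLift hf).restrict_scalars ℝ).contDiffAt.comp _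
      (hQ t (hIoo t ht)).1).congr_of_eventuallyEq (hs t ht)
  · refine isBigO_sq_of_eq_sq_mul (H := fun t => √(∑ i, 2 * ‖g i (0, t)‖ ^ 2)) ?_
      (by fun_prop)
    filter_upwards [hev] with t ht
    have h := (hds t ht).self_of_nhds.2.2
    have e : ∀ i, fiberInner (0, t) (extD s (0, t) (frame (0, t) i))
        (extD s (0, t) (frame (0, t) i)) = (t ^ 2) ^ 2 * (2 * ‖g i (0, t)‖ ^ 2) := by
      intro i
      have e1 : extD s (0, t) (frame (0, t) i) = ![0, 0, t * g i (0, t)] := by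
        rw [extD, frame, map_smul, h i, (hQ t (hIoo t ht)).2]
        ext j
        fin_cases j <;> simp [squareField]
      rw [e1, fiberInner_axis ht.1.ne', norm_mul, Complex.norm_real, Real.norm_of_nonneg ht.1.le]
      simp
      ring
    rw [formNorm, Finset.sum_congr rfl fun i _ => e i, ← Finset.mul_sum,
      Real.sqrt_mul (by positivity), Real.sqrt_sq (by positivity)]
  · set b : ℝ → ℂ := fun t =>
      ∑ i, g i (0, t) * ((coordVec i).1 - fderiv ℝ Q (0, t) (coordVec i)) with hb
    -- One factor `t` has been divided out of the `z²`-coefficient of `codiff_axis`; the fibre norm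
    -- restores a second one.
    set c : ℝ → ℂ := fun t => t * ∑ i, fderiv ℝ (g i) (0, t) (coordVec i) +
      ∑ i, (coordVec i).2 * g i (0, t) with hc
    have cb : ContinuousAt b 0 := by fun_prop
    have cc : ContinuousAt c 0 := by fun_prop
    -- The `4` is the square of the factor in `2 t² b`; the `2` is the weight in `fiberInner_axis`.
    refine isBigO_sq_of_eq_sq_mul (H := fun t => √(4 * ‖b t‖ ^ 2 + 2 * ‖c t‖ ^ 2)) ?_
      (by fun_prop)
    filter_upwards [hev] with t ht
    have ht' := hIoo t ht
    have e := codiff_axis ht.1 (α := extD s) (hgd t ht') (hQd t ht') (hQ t ht').2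
      (fun i => (hds t ht).mono fun y hy => hy.2.2 i)
    have e2 : (t : ℂ) ^ 2 * ∑ i, fderiv ℝ (g i) (0, t) (coordVec i) +
        t * ∑ i, (coordVec i).2 * g i (0, t) = t * c t := by
      simp only [hc]; ring
    rw [laplacian, fiberNorm, e, e2, fiberInner_axis ht.1.ne', ← Real.sqrt_sq (sq_nonneg t),
      ← Real.sqrt_mul (by positivity), Real.sqrt_sq (sq_nonneg t)]
    congr 1
    simp only [norm_neg, norm_mul, norm_pow, Complex.norm_real, Real.norm_of_nonneg ht.1.le,
      Complex.norm_ofNat]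
    ring
  · refine isBigO_sq_of_eq_sq_mul (H := fun t => (g 1 (0, t)).im - (g 0 (0, t)).re) ?_
      ((Complex.continuous_im.continuousAt.comp (cg 1)).sub
        (Complex.continuous_re.continuousAt.comp (cg 0)))
    filter_upwards [hev] with t ht
    rw [(hdiv t ht).self_of_nhds]
    simp [(hQ t (hIoo t ht)).2, ← Complex.ofReal_pow]
    ring
  · set K : Fin 3 → ℝ → ℝ := fun j t =>
      -(2 * (coordVec j).2) * ((g 0 (0, t)).re - (g 1 (0, t)).im) -
        t * ((fderiv ℝ (g 0) (0, t) (coordVec j)).re - (fderiv ℝ (g 1) (0, t) (coordVec j)).im) +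
        (2 * g 2 (0, t) * ((coordVec j).1 - fderiv ℝ Q (0, t) (coordVec j))).re with hK
    have cK : ∀ j, ContinuousAt (K j) 0 := by
      intro j
      have hre : ∀ {F : ℝ → ℂ}, ContinuousAt F 0 → ContinuousAt (fun t => (F t).re) 0 :=
        fun hF => Complex.continuous_re.continuousAt.comp hF
      have him : ∀ {F : ℝ → ℂ}, ContinuousAt F 0 → ContinuousAt (fun t => (F t).im) 0 :=
        fun hF => Complex.continuous_im.continuousAt.comp hF
      exact ((continuousAt_const.mul ((hre (cg 0)).sub (him (cg 1)))).sub
        (continuousAt_id.mul ((hre (cg' 0 _)).sub (him (cg' 1 _))))).add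
          (hre ((continuousAt_const.mul (cg 2)).mul (continuousAt_const.sub (cQ _))))
    refine isBigO_sq_of_eq_sq_mul (H := fun t => √(∑ j, K j t ^ 2)) ?_ (by fun_prop)
    filter_upwards [hev] with t ht
    have ht' := hIoo t ht
    have e : ∀ j, fderiv ℝ (divergence (realPart s)) (0, t) (frame (0, t) j) = t ^ 2 * K j t := by
      intro j
      rw [(hdiv t ht).fderiv_eq, frame, map_smul,
        fderiv_divergence_model (hgd t ht') (hQd t ht') (hQ t ht').2]
      simp only [hK, smul_eq_mul]
      ring
    simp only [normDiff, e, mul_pow]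
    rw [← Finset.mul_sum, Real.sqrt_mul (by positivity), Real.sqrt_sq (by positivity)]

end HypExt

theorem proposition3p2 (O : Set (ℂ × ℝ)) (φ : ℂ × ℝ → ℝ)
    (hS : HypExt.IsConvexSurface O φ) (hN : HypExt.IsNormalized O φ)
    (f : ℂ → ℂ) (hf : Differentiable ℂ f) :
    (∃ (V : Set (ℂ × ℝ)) (P : ℂ × ℝ → ℂ), HypExt.IsNormalProjection O φ V P) ∧
    ∀ (V : Set (ℂ × ℝ)) (P : ℂ × ℝ → ℂ), HypExt.IsNormalProjection O φ V P →
      ∀ s : ℂ × ℝ → HypExt.ProjField, s = (fun q => HypExt.canonicalLift f (P q)) →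
        (∀ t ∈ Set.Ioo (0 : ℝ) 1, ContDiffAt ℝ ∞ s (0, t)) ∧
        (fun t : ℝ => HypExt.formNorm (0, t) (HypExt.extD s (0, t)))
          =O[𝓝[>] 0] (fun t : ℝ => t ^ 2) ∧
        (fun t : ℝ => HypExt.fiberNorm (0, t) (HypExt.laplacian s (0, t)))
          =O[𝓝[>] 0] (fun t : ℝ => t ^ 2) ∧
        (fun t : ℝ => HypExt.divergence (HypExt.realPart s) (0, t))
          =O[𝓝[>] 0] (fun t : ℝ => t ^ 2) ∧
        (fun t : ℝ => HypExt.normDiff (HypExt.divergence (HypExt.realPart s)) (0, t))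
          =O[𝓝[>] 0] (fun t : ℝ => t ^ 2) := by
  obtain ⟨Q, ⟨V₀, hV₀⟩, hQ, hPQ⟩ := HypExt.exists_projection_chart hS hN
  refine ⟨⟨V₀, Q, hV₀⟩, fun V P hP s hs => HypExt.estimates_of_chart hf hQ fun t ht => ?_⟩
  filter_upwards [hPQ V P hP t ht] with q hq
  rw [hs]
  simp only [hq]
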